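/- **Theorem.** Let $G$ be a unimodular locally compact second-countable Hausdorff group with identity $e$ and Haar measure $m$ (written $dx$), let $\sigma\colon G\times G\to\mathbb T$ be a continuous 2-cocycle with $\sigma(e,e)=1$, and let $\pi$ be a strongly continuous irreducible $\sigma$-projective unitary representation of $G$ on a Hilbert space $\mathcal H_\pi$ (so $\pi(x)\pi(y)=\sigma(x,y)\pi(xy)$) that is *discrete series*: $\int_G|\langle\xi,\pi(x)\xi\rangle|^2\,dx<\infty$ for some $\xi\neq0$. Its formal dimension is the number $d_\pi>0$ with $$\int_G\langle\xi,\pi(x)\eta\rangle\overline{\langle\xi',\pi(x)\eta'\rangle}\,dx=d_\pi^{-1}\langle\xi,\xi'\rangle\overline{\langle\eta,\eta'\rangle}\qquad(\xi,\xi',\eta,\eta'\in\mathcal H_\pi).$$ Let $\mathcal B_\pi$ be the set of $\eta\in\mathcal H_\pi$ such that, for every $\xi\in\mathcal H_\pi$, both $f(x)=\langle\xi,\pi(x)\eta\rangle$ and $f^\natural(x)=\sup_{t\in xQ}|f(t)|$ belong to $L^2(G)$, where $Q$ is a fixed compact neighbourhood of $e$ (which may be arbitrary). A set $\Lambda\subseteq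 G$ is *relatively separated* if there are a nonempty open $U\subseteq G$ and $\ell\in\mathbb N$ with $|\Lambda\cap xU|\le\ell$ for all $x\in G$; such a set is closed. For relatively separated $\Lambda$, let $\Omega(\Lambda)$ be the closure of $\{x\Lambda:x\in G\}$ in the space of closed subsets of $G$ with the Chabauty–Fell topology, $\Omega^\times(\Lambda)=\Omega(\Lambda)\setminus\{\emptyset\}$ and $\Omega_0(\Lambda)=\{P\in\Omega(\Lambda):e\in P\}$. For a $G$-invariant Borel probability measure $\mu$ on $\Omega^\times(\Lambda)$ there is a unique finite measure $\mu_0$ on $\Omega_0(\Lambda)$, the transverse measure of $\mu$, with $$\int_{\Omega^\times(\Lambda)}\sum_{x\in P}F(x,x^{-1}P)\,d\mu(P)=\int_{\Omega_0(\Lambda)}\int_GF(x,Q)\,dx\,d\mu_0(Q)\qquad(F\in C_c(G\times\Omega_0(\Lambda))).$$ Put $\operatorname{covol}_\mu(\Lambda)=\mu(\Omega^\times(\Lambda))/\mu_0(\Omega_0(\Lambda))$, and let $\operatorname{covol}_-(\Lambda)$ and $\operatorname{covol}_+(\Lambda)$ be the infimum and the supremum in $[0,\infty]$ of $\operatorname{covol}_\mu(\Lambda)$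 over all such $\mu$ (so they equal $\infty$ and $0$, respectively, if there is no such $\mu$). Let $\Lambda\subseteq G$ be any subset. Then: 1. If $\eta\in\mathcal B_\pi$ and $(\pi(\lambda)\eta)_{\lambda\in\Lambda}$ is a frame for $\mathcal H_\pi$, then $\Lambda$ is relatively separated and $d_\pi\operatorname{covol}_+(\Lambda)\le1$. 2. If $\eta\in\mathcal H_\pi$ and $(\pi(\lambda)\eta)_{\lambda\in\Lambda}$ is a Riesz sequence in $\mathcal H_\pi$, then $\Lambda$ is relatively separated and $d_\pi\operatorname{covol}_-(\Lambda)\ge1$. Here a family $(e_j)_{j\in J}$ is a frame if $A\|\xi\|^2\le\sum_j|\langle\xi,e_j\rangle|^2\le B\|\xi\|^2$ for all $\xi$, with some $0<A\le B<\infty$; it is a Riesz sequence if $A\|c\|_2^2\le\|\sum_jc_je_j\|^2\le B\|c\|_2^2$ for all $c\in\ell^2(J)$ (the series being convergent), with some $A,B>0$. -/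

import Mathlib

open MeasureTheory Topology Set
open scoped Pointwise ENNReal ComplexConjugate

noncomputable section

namespace CoherentSystems

/-! ### Frames and Riesz sequences -/

/-- A family of vectors `e j` in a Hilbert space is a frame if, for some `0 < A ≤ B < ∞`,
`A ‖ξ‖² ≤ ∑ |⟨ξ, e j⟩|² ≤ B ‖ξ‖²` for all `ξ`. The sum of nonnegative terms is taken in `[0, ∞]`. -/
def IsFrame {H J : Type*} [NormedAddCommGroup H] [InnerProductSpace ℂ H] (e : J → H) : Prop :=
  ∃ A B : ℝ, 0 < A ∧ A ≤ B ∧ ∀ ξ : H,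
    ENNReal.ofReal (A * ‖ξ‖ ^ 2) ≤ ∑' j, ‖inner ℂ (e j) ξ‖ₑ ^ 2 ∧
    ∑' j, ‖inner ℂ (e j) ξ‖ₑ ^ 2 ≤ ENNReal.ofReal (B * ‖ξ‖ ^ 2)

/-- A family of vectors `e j` in a Hilbert space is a Riesz sequence if, for some `A, B > 0` and
for all `c ∈ ℓ²(J)`, the series `∑ c j • e j` converges and
`A ‖c‖² ≤ ‖∑ c j • e j‖² ≤ B ‖c‖²`. -/
def IsRieszSequence {H J : Type*} [NormedAddCommGroup H] [InnerProductSpace ℂ H]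
    (e : J → H) : Prop :=
  ∃ A B : ℝ, 0 < A ∧ 0 < B ∧ ∀ c : lp (fun _ : J => ℂ) 2,
    Summable (fun j => c j • e j) ∧
    A * ‖c‖ ^ 2 ≤ ‖∑' j, c j • e j‖ ^ 2 ∧ ‖∑' j, c j • e j‖ ^ 2 ≤ B * ‖c‖ ^ 2

/-! ### Projective unitary representations -/

/-- A continuous 2-cocycle on `G` with values in the circle. -/
structure Cocycle (G : Type*) [Group G] [TopologicalSpace G] where
  toFun : G → G → Circle
  continuous_toFun : Continuous fun p : G × G => toFun p.1 p.2
  cocycle : ∀ x y z, toFun x y * toFun (x * y) z = toFun x (y * z) * toFun y z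
  map_one_one : toFun 1 1 = 1

/-- A strongly continuous `σ`-projective unitary representation of `G` on `H`. -/
structure ProjRep {G : Type*} [Group G] [TopologicalSpace G] (σ : Cocycle G)
    (H : Type*) [NormedAddCommGroup H] [InnerProductSpace ℂ H] where
  toFun : G → H ≃ₗᵢ[ℂ] H
  map_mul : ∀ x y ξ, toFun x (toFun y ξ) = (σ.toFun x y : ℂ) • toFun (x * y) ξ
  strongly_continuous : ∀ ξ, Continuous fun x => toFun x ξ

namespace ProjRep

variable {G : Type*} [Group G] [TopologicalSpace G] {σ : Cocycle G}
  {H : Type*} [NormedAddCommGroup H] [InnerProductSpace ℂ H]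

/-- `π` is irreducible: `H ≠ 0`, and the only closed `π`-invariant subspaces are `0` and `H`. -/
def IsIrreducible (π : ProjRep σ H) : Prop :=
  Nontrivial H ∧ ∀ V : Submodule ℂ H, IsClosed (V : Set H) →
    (∀ x, ∀ ξ ∈ V, π.toFun x ξ ∈ V) → V = ⊥ ∨ V = ⊤

/-- The matrix coefficient `C_η ξ (x) = ⟨ξ, π(x) η⟩`. The inner product of the text is linear in
the first variable, Mathlib's is linear in the second one. -/
def coeff (π : ProjRep σ H) (η ξ : H) (x : G) : ℂ := inner ℂ (π.toFun x η) ξ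

variable [MeasurableSpace G]

/-- `π` is a discrete series representation: it is irreducible and
`∫ |⟨ξ, π(x) ξ⟩|² dx < ∞` for some nonzero vector `ξ`. -/
def IsDiscreteSeries (π : ProjRep σ H) (m : Measure G) : Prop :=
  π.IsIrreducible ∧ ∃ ξ : H, ξ ≠ 0 ∧ ∫⁻ x, ‖π.coeff ξ ξ x‖ₑ ^ 2 ∂m < ∞

/-- The number `d > 0` satisfies the orthogonality relations: all matrix coefficients are square
integrable and `∫ ⟨ξ, π(x) η⟩ conj ⟨ξ', π(x) η'⟩ dx = d⁻¹ ⟨ξ, ξ'⟩ conj ⟨η, η'⟩`. -/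
def IsFormalDimension (π : ProjRep σ H) (m : Measure G) (d : ℝ) : Prop :=
  0 < d ∧ (∀ ξ η, MemLp (π.coeff η ξ) 2 m) ∧ ∀ ξ ξ' η η',
    ∫ x, π.coeff η ξ x * conj (π.coeff η' ξ' x) ∂m =
      (d : ℂ)⁻¹ * inner ℂ ξ' ξ * conj (inner ℂ η' η)

open Classical in
/-- The formal dimension `d_π` of a discrete series representation: the unique positive number
satisfying the orthogonality relations (and `0` if there is none). -/
def formalDimension (π : ProjRep σ H) (m : Measure G) : ℝ :=
  if h : ∃ d, π.IsFormalDimension m d then h.choose else 0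

end ProjRep

/-- The local maximum function `f♮(x) = sup_{t ∈ xQ} |f(t)|`, with values in `[0, ∞]`. -/
def localMax {G : Type*} [Group G] (Q : Set G) (f : G → ℂ) (x : G) : ℝ≥0∞ :=
  ⨆ t ∈ x • Q, ‖f t‖ₑ

/-- Membership in the Wiener amalgam space `W²(G)`, computed with the set `Q`. -/
def MemWiener {G : Type*} [Group G] [MeasurableSpace G] (m : Measure G) (Q : Set G)
    (f : G → ℂ) : Prop :=
  MemLp f 2 m ∧ MemLp (localMax Q f) 2 m

/-- `η` belongs to the space `B_π` of admissible vectors: `C_η ξ ∈ W²(G)` for all `ξ`. -/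
def ProjRep.IsAdmissible {G : Type*} [Group G] [TopologicalSpace G] [MeasurableSpace G]
    {σ : Cocycle G} {H : Type*} [NormedAddCommGroup H] [InnerProductSpace ℂ H]
    (π : ProjRep σ H) (m : Measure G) (Q : Set G) (η : H) : Prop :=
  ∀ ξ, MemWiener m Q (π.coeff η ξ)

/-! ### The Chabauty–Fell space of closed subsets -/

/-- The set of closed subsets of `G`, to be endowed with the Chabauty–Fell topology. -/
@[ext]
structure ClosedSubsets (G : Type*) [TopologicalSpace G] where
  carrier : Set G
  isClosed : IsClosed carrier

namespace ClosedSubsets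

variable {G : Type*} [TopologicalSpace G]

/-- The Chabauty–Fell topology. -/
instance : TopologicalSpace (ClosedSubsets G) :=
  TopologicalSpace.generateFrom
    ({S | ∃ K : Set G, IsCompact K ∧ S = {C : ClosedSubsets G | C.carrier ∩ K = ∅}} ∪
     {S | ∃ V : Set G, IsOpen V ∧ S = {C : ClosedSubsets G | (C.carrier ∩ V).Nonempty}})

instance : MeasurableSpace (ClosedSubsets G) := borel _

instance : BorelSpace (ClosedSubsets G) := ⟨rfl⟩

variable [Group G] [IsTopologicalGroup G]

/-- The action of `G` on closed sets by left translation. -/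
instance : MulAction G (ClosedSubsets G) where
  smul x C := ⟨x • C.carrier, C.isClosed.smul x⟩
  one_smul C := ClosedSubsets.ext (one_smul G C.carrier)
  mul_smul x y C := ClosedSubsets.ext (mul_smul x y C.carrier)

theorem carrier_smul (x : G) (C : ClosedSubsets G) : (x • C).carrier = x • C.carrier := rfl

theorem continuous_const_smul (x : G) : Continuous fun C : ClosedSubsets G => x • C := by
  have key : ∀ (A : Set G) (C : ClosedSubsets G),
      (x • C).carrier ∩ A = x • (C.carrier ∩ x⁻¹ • A) := by
    intro A C
    rw [carrier_smul, Set.smul_set_inter, smul_inv_smul]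
  refine continuous_generateFrom_iff.2 ?_
  rintro S (⟨K, hK, rfl⟩ | ⟨V, hV, rfl⟩)
  · refine TopologicalSpace.isOpen_generateFrom_of_mem (Or.inl ⟨x⁻¹ • K, hK.smul _, ?_⟩)
    ext C
    simp only [mem_preimage, mem_ofPred_eq, key, smul_set_eq_empty]
  · refine TopologicalSpace.isOpen_generateFrom_of_mem (Or.inr ⟨x⁻¹ • V, hV.smul _, ?_⟩)
    ext C
    simp only [mem_preimage, mem_ofPred_eq, key, smul_set_nonempty]

end ClosedSubsets

section Hull

variable {G : Type*} [Group G] [TopologicalSpace G]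

/-- `Λ` is relatively separated: for some nonempty open `U` and some natural number `ℓ`,
`|Λ ∩ xU| ≤ ℓ` for all `x ∈ G`. -/
def IsRelSeparated (Λ : Set G) : Prop :=
  ∃ U : Set G, IsOpen U ∧ U.Nonempty ∧ ∃ l : ℕ, ∀ x : G, (Λ ∩ x • U).encard ≤ l

/-- The hull of `Λ`: the closure of the set of translates `xΛ` in the Chabauty–Fell space. -/
def hull (Λ : Set G) : Set (ClosedSubsets G) :=
  closure {C | ∃ x : G, C.carrier = x • Λ}

/-- The punctured hull: the hull without the empty set. -/
def PuncturedHull (Λ : Set G) : Type _ :=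
  {P : ClosedSubsets G // P ∈ hull Λ ∧ P.carrier.Nonempty}

/-- The transversal: the elements of the hull that contain the identity. -/
def Transversal (Λ : Set G) : Type _ :=
  {P : ClosedSubsets G // P ∈ hull Λ ∧ (1 : G) ∈ P.carrier}

variable {Λ : Set G}

instance : TopologicalSpace (PuncturedHull Λ) :=
  inferInstanceAs (TopologicalSpace {P : ClosedSubsets G // P ∈ hull Λ ∧ P.carrier.Nonempty})

instance : MeasurableSpace (PuncturedHull Λ) :=
  inferInstanceAs (MeasurableSpace {P : ClosedSubsets G // P ∈ hull Λ ∧ P.carrier.Nonempty})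

instance : BorelSpace (PuncturedHull Λ) :=
  inferInstanceAs (BorelSpace {P : ClosedSubsets G // P ∈ hull Λ ∧ P.carrier.Nonempty})

instance : TopologicalSpace (Transversal Λ) :=
  inferInstanceAs (TopologicalSpace {P : ClosedSubsets G // P ∈ hull Λ ∧ (1 : G) ∈ P.carrier})

instance : MeasurableSpace (Transversal Λ) :=
  inferInstanceAs (MeasurableSpace {P : ClosedSubsets G // P ∈ hull Λ ∧ (1 : G) ∈ P.carrier})

instance : BorelSpace (Transversal Λ) :=
  inferInstanceAs (BorelSpace {P : ClosedSubsets G // P ∈ hull Λ ∧ (1 : G) ∈ P.carrier})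

variable [IsTopologicalGroup G]

theorem smul_mem_hull (x : G) {P : ClosedSubsets G} (hP : P ∈ hull Λ) : x • P ∈ hull Λ := by
  refine map_mem_closure (ClosedSubsets.continuous_const_smul x) hP ?_
  rintro C ⟨y, hy⟩
  exact ⟨x * y, by rw [ClosedSubsets.carrier_smul, hy, mul_smul]⟩

/-- The action of `G` on the punctured hull by left translation. -/
instance : MulAction G (PuncturedHull Λ) where
  smul x P := ⟨x • P.1, smul_mem_hull x P.2.1, P.2.2.smul_set⟩
  one_smul P := Subtype.ext (one_smul G P.1)
  mul_smul x y P := Subtype.ext (mul_smul x y P.1)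

/-- For `P` in the punctured hull and `x ∈ P`, the element `x⁻¹P` of the transversal. -/
def PuncturedHull.toTransversal (P : PuncturedHull Λ) (x : P.1.carrier) : Transversal Λ :=
  ⟨(x : G)⁻¹ • P.1, smul_mem_hull _ P.2.1,
    (Set.mem_smul_set_iff_inv_smul_mem).2 (by simp)⟩

variable [MeasurableSpace G]

/-- The finite measure `μ₀` on the transversal is a transverse measure of the measure `μ` on the
punctured hull: `∫ ∑_{x ∈ P} F(x, x⁻¹P) dμ(P) = ∫ ∫ F(x, Q) dx dμ₀(Q)` for all continuous
compactly supported functions `F` on the product of `G` and the transversal. -/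
def IsTransverseMeasure (m : Measure G) (μ : Measure (PuncturedHull Λ))
    (μ₀ : Measure (Transversal Λ)) : Prop :=
  IsFiniteMeasure μ₀ ∧ ∀ F : G × Transversal Λ → ℝ, Continuous F → HasCompactSupport F →
    ∫ P : PuncturedHull Λ, ∑' x : P.1.carrier, F ((x : G), P.toTransversal x) ∂μ =
      ∫ Q, ∫ x, F (x, Q) ∂m ∂μ₀

open Classical in
/-- The transverse measure of `μ`. It exists and is unique if `Λ` is relatively separated and `μ`
is a nonzero finite invariant measure; it is set to `0` if there is none. -/
def transverseMeasure (m : Measure G) (μ : Measure (PuncturedHull Λ)) :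
    Measure (Transversal Λ) :=
  if h : ∃ μ₀, IsTransverseMeasure m μ μ₀ then h.choose else 0

/-- The covolume of `Λ` with respect to an invariant measure `μ` on the punctured hull. -/
def covol (m : Measure G) (μ : Measure (PuncturedHull Λ)) : ℝ≥0∞ :=
  μ univ / transverseMeasure m μ univ

/-- The set of invariant probability measures on the punctured hull. -/
def invariantProb (Λ : Set G) : Set (Measure (PuncturedHull Λ)) :=
  {μ | IsProbabilityMeasure μ ∧ SMulInvariantMeasure G (PuncturedHull Λ) μ}

/-- The lower covolume (equal to `∞` if there is no invariant probability measure). -/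
def lowerCovol (m : Measure G) (Λ : Set G) : ℝ≥0∞ := ⨅ μ ∈ invariantProb Λ, covol m μ

/-- The upper covolume (equal to `0` if there is no invariant probability measure). -/
def upperCovol (m : Measure G) (Λ : Set G) : ℝ≥0∞ := ⨆ μ ∈ invariantProb Λ, covol m μ

end Hull

end CoherentSystems

end

/-! For `P` in the hull let `C_P` be the analysis operator of the system `(π(p)η)_{p ∈ P}`, `S_P =
C_P* C_P` its frame operator, and `R_P = B⁻¹ ∑_{k < n} (1 - B⁻¹ S_P)ᵏ` a polynomial in `S_P` that
imitates its inverse. Since `π(x) S_P π(x)* = S_{xP}`, the same holds for `R_P`. Take `F(x, Q) = ⟨ξ,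
π(x) R_Q η⟩ conj ⟨ξ, π(x)η⟩` in the formula defining the transverse measure. By equivariance the sum
over `P` collapses to `⟨S_P R_P ξ, ξ⟩`, and the orthogonality relations evaluate the integral over
`G`. The result is the trace formula `∫ ⟨S_P R_P ξ, ξ⟩ dμ = d⁻¹ ‖ξ‖² ∫ ⟨R_Q η, η⟩ dμ₀`
(`integral_inner_frameOp_richardson`).

For `n = 2k` both integrands are defects from a norm square. The left one is `‖ξ‖² - ‖(1 - B⁻¹ C*C)ᵏ
ξ‖²`. As `1 ∈ Q`, the vector `η` is `C_Q* δ₁`, so the right one is `1 - ‖(1 - B⁻¹ CC*)ᵏ δ₁‖²`. Hence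
they never exceed `‖ξ‖²` and `1`. A lower frame bound uniform on the hull makes the left one tend to
`‖ξ‖²` as `k → ∞`; a uniform lower Riesz bound makes the right one tend to `1`. So frames give `d ≤
μ₀(univ)` and Riesz sequences give `μ₀(univ) ≤ d`, while the covolume of a probability measure is
`μ₀(univ)⁻¹`.

Three inputs remain. The orthogonality relations follow from Schur's lemma applied to the closed
graph of a coefficient operator (`IsIrreducible.exists_norm_coeff_eq`). The transverse measure comes
from uniqueness of Haar measure, applied to the first coordinate of the Campbell measure
(`exists_campbellMeasure_eq_prod`). Finally the bounds must pass from `Λ` to its hull: Bessel and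
Riesz bounds are closed conditions on finitely many points, whereas the lower frame bound needs the
uniform tail estimate supplied by admissibility of `η` (`ProjRep.lower_bound_of_mem_hull`). -/

noncomputable section

set_option linter.unusedSectionVars false

namespace CoherentSystems

/-! ### Bessel families and their frame operators -/

/-! ### Polynomial approximation of the inverse of a positive operator -/

section Richardson

variable {H E : Type*} [NormedAddCommGroup H] [InnerProductSpace ℂ H] [CompleteSpace H]
  [NormedAddCommGroup E] [InnerProductSpace ℂ E] [CompleteSpace E]

open ContinuousLinearMap

/-- The Richardson approximation `B⁻¹ ∑_{k < n} (1 - B⁻¹ S)ᵏ` of the inverse of `S`. -/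
def richardson (S : H →L[ℂ] H) (B : ℝ) (n : ℕ) : H →L[ℂ] H :=
  (B : ℂ)⁻¹ • ∑ k ∈ Finset.range n, (1 - (B : ℂ)⁻¹ • S) ^ k

/-- The geometric sum telescopes, so the failure to invert `S` is exactly a power of `1 - B⁻¹ S`. -/
theorem mul_richardson (S : H →L[ℂ] H) (B : ℝ) (n : ℕ) :
    S * richardson S B n = 1 - (1 - (B : ℂ)⁻¹ • S) ^ n := by
  rw [richardson, mul_smul_comm, ← smul_mul_assoc, ← mul_neg_geom_sum, sub_sub_cancel]

theorem richardson_mul_eq (S : H →L[ℂ] H) (B : ℝ) (n : ℕ) :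
    richardson S B n * S = S * richardson S B n := by
  have h : Commute S (richardson S B n) := by
    refine Commute.smul_right (Commute.sum_right _ _ _ fun k _ => Commute.pow_right ?_ k) _
    exact (Commute.one_right _).sub_right ((Commute.refl S).smul_right _)
  exact h.eq.symm

/-- An intertwiner of two operators intertwines all polynomials in them. It serves twice: with an
analysis operator, to exchange `C*C` and `CC*`, and with `π(x)`, for equivariance. -/
theorem comp_richardson_of_comp_eq {S : H →L[ℂ] H} {S' : E →L[ℂ] E} {C : H →L[ℂ] E}
    (h : C ∘L S = S' ∘L C) (B : ℝ) (n : ℕ) (x : H) :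
    C (richardson S B n x) = richardson S' B n (C x) := by
  have h1 : ∀ x, C (S x) = S' (C x) := fun x => DFunLike.congr_fun h x
  have hk : ∀ (k : ℕ) (x : H), C (((1 - (B : ℂ)⁻¹ • S) ^ k) x) =
      ((1 - (B : ℂ)⁻¹ • S') ^ k) (C x) := by
    intro k
    induction k with
    | zero => intro x; simp
    | succ k ih =>
      intro x
      rw [pow_succ, pow_succ, mul_apply_eq_comp, mul_apply_eq_comp, ih]
      simp only [sub_apply, one_apply_eq_self, smul_apply, map_sub, map_smul, h1]
  simp only [richardson, smul_apply, sum_apply, map_smul, map_sum, hk]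

theorem isSelfAdjoint_one_sub_smul_adjoint_comp (C : H →L[ℂ] E) (B : ℝ) :
    IsSelfAdjoint (1 - (B : ℂ)⁻¹ • (adjoint C ∘L C)) := by
  refine (IsSelfAdjoint.one _).sub (IsSelfAdjoint.smul ?_ ?_)
  · simp [isSelfAdjoint_iff, ← Complex.ofReal_inv]
  · exact (IsPositive.isSelfAdjoint (isPositive_adjoint_comp_self C))

/-- With an even number of terms the defect is the square of the self-adjoint operator `(1 - B⁻¹
C*C)ᵏ`; its quadratic form is therefore a norm square, and has a sign. -/
theorem inner_adjoint_comp_richardson (C : H →L[ℂ] E) (B : ℝ) (k : ℕ) (x : H) :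
    inner ℂ x ((adjoint C ∘L C) (richardson (adjoint C ∘L C) B (2 * k) x)) =
      ((‖x‖ ^ 2 - ‖((1 - (B : ℂ)⁻¹ • (adjoint C ∘L C)) ^ k) x‖ ^ 2 : ℝ) : ℂ) := by
  have h := DFunLike.congr_fun (mul_richardson (adjoint C ∘L C) B (2 * k)) x
  have hM := ((isSelfAdjoint_one_sub_smul_adjoint_comp C B).pow k)
  rw [show (adjoint C ∘L C) (richardson (adjoint C ∘L C) B (2 * k) x) =
    (adjoint C ∘L C * richardson (adjoint C ∘L C) B (2 * k)) x from rfl, h]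
  rw [sub_apply, inner_sub_right, one_apply_eq_self, inner_self_eq_norm_sq_to_K, two_mul,
    pow_add]
  rw [show ((1 - (B : ℂ)⁻¹ • (adjoint C ∘L C)) ^ k * (1 - (B : ℂ)⁻¹ • (adjoint C ∘L C)) ^ k) x =
    ((1 - (B : ℂ)⁻¹ • (adjoint C ∘L C)) ^ k) (((1 - (B : ℂ)⁻¹ • (adjoint C ∘L C)) ^ k) x) from rfl,
    ← adjoint_inner_left, hM.adjoint_eq, inner_self_eq_norm_sq_to_K]
  push_cast
  rfl

/-- Because `C R(C*C) = R(CC*) C`, this is the preceding identity for `C*` in place of `C`. -/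
theorem inner_adjoint_richardson_adjoint (C : H →L[ℂ] E) (B : ℝ) (k : ℕ) (c : E) :
    inner ℂ (adjoint C c) (richardson (adjoint C ∘L C) B (2 * k) (adjoint C c)) =
      ((‖c‖ ^ 2 - ‖((1 - (B : ℂ)⁻¹ • (C ∘L adjoint C)) ^ k) c‖ ^ 2 : ℝ) : ℂ) := by
  have h := inner_adjoint_comp_richardson (adjoint C) B k c
  rw [adjoint_adjoint] at h
  have h1 := comp_richardson_of_comp_eq (S := adjoint C ∘L C) (S' := C ∘L adjoint C) (C := C) rfl
    B (2 * k) (adjoint C c)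
  rw [← h, adjoint_inner_left, h1]
  exact congrArg _ (DFunLike.congr_fun (richardson_mul_eq (C ∘L adjoint C) B (2 * k)) c)

/-- As quadratic forms `0 ≤ 1 - B⁻¹ C*C ≤ 1 - A / B`, and the norm of a positive operator is the
least scalar above it. The case `A = 0` says that the operator is a contraction. -/
theorem norm_one_sub_smul_adjoint_comp_le {C : H →L[ℂ] E} {A B : ℝ} (hB : 0 < B) (hAB : A ≤ B)
    (hA : ∀ x, A * ‖x‖ ^ 2 ≤ ‖C x‖ ^ 2) (hC : ∀ x, ‖C x‖ ^ 2 ≤ B * ‖x‖ ^ 2) :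
    ‖1 - (B : ℂ)⁻¹ • (adjoint C ∘L C)‖ ≤ 1 - A / B := by
  have hs := isSelfAdjoint_one_sub_smul_adjoint_comp C B
  have key : ∀ x, reApplyInnerSelf (1 - (B : ℂ)⁻¹ • (adjoint C ∘L C)) x =
      ‖x‖ ^ 2 - B⁻¹ * ‖C x‖ ^ 2 := by
    intro x
    rw [reApplyInnerSelf_apply, sub_apply, inner_sub_left, one_apply_eq_self, smul_apply,
      inner_smul_left, comp_apply, adjoint_inner_left, inner_self_eq_norm_sq_to_K,
      inner_self_eq_norm_sq_to_K]
    simp [← Complex.ofReal_inv, ← Complex.ofReal_pow]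
  have h0 : 0 ≤ 1 - (B : ℂ)⁻¹ • (adjoint C ∘L C) := by
    rw [nonneg_iff_isPositive, isPositive_def']
    refine ⟨hs, fun x => ?_⟩
    rw [key, sub_nonneg, inv_mul_le_iff₀ hB]
    exact hC x
  have hr : 0 ≤ 1 - A / B := by
    rw [sub_nonneg, div_le_one hB]; exact hAB
  rw [CStarAlgebra.norm_le_iff_le_algebraMap _ hr h0, le_def, isPositive_def']
  refine ⟨?_, fun x => ?_⟩
  · exact (IsSelfAdjoint.algebraMap _ (IsSelfAdjoint.all _)).sub hs
  · have h2 : reApplyInnerSelf (algebraMap ℝ (H →L[ℂ] H) (1 - A / B)) x =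
        (1 - A / B) * ‖x‖ ^ 2 := by
      rw [reApplyInnerSelf_apply, Algebra.algebraMap_eq_smul_one, smul_apply, one_apply_eq_self,
        ← Complex.coe_smul, inner_smul_left, inner_self_eq_norm_sq_to_K]
      simp [← Complex.ofReal_pow]
    have h3 := key x
    rw [reApplyInnerSelf_apply] at h2 h3 ⊢
    rw [sub_apply, inner_sub_left, map_sub, h2, h3]
    have := hA x
    have h4 : A / B * ‖x‖ ^ 2 ≤ B⁻¹ * ‖C x‖ ^ 2 := by
      rw [div_mul_eq_mul_div, div_eq_inv_mul]
      gcongr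
    linarith

end Richardson

/-! ### Analysis, synthesis and Riesz bounds -/

section Bessel

variable {H J : Type*} [NormedAddCommGroup H] [InnerProductSpace ℂ H]

/-- A Bessel family with bound `B`. -/
def IsBessel (e : J → H) (B : ℝ) : Prop :=
  ∀ ξ : H, ∑' j, ‖inner ℂ (e j) ξ‖ₑ ^ 2 ≤ ENNReal.ofReal (B * ‖ξ‖ ^ 2)

variable {e : J → H} {B : ℝ}

theorem tsum_enorm_sq_lt_top_iff {c : J → ℂ} :
    ∑' j, ‖c j‖ₑ ^ 2 ≠ ∞ ↔ Summable fun j => ‖c j‖ ^ 2 := by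
  have : ∀ j, ‖c j‖ₑ ^ 2 = ((‖c j‖₊ ^ 2 : NNReal) : ℝ≥0∞) := fun j => by
    rw [ENNReal.coe_pow]; rfl
  simp_rw [this]
  rw [ENNReal.tsum_coe_ne_top_iff_summable, ← NNReal.summable_coe]
  simp

theorem tsum_enorm_sq_eq {c : J → ℂ} (hc : Summable fun j => ‖c j‖ ^ 2) :
    ∑' j, ‖c j‖ₑ ^ 2 = ENNReal.ofReal (∑' j, ‖c j‖ ^ 2) := by
  rw [ENNReal.ofReal_tsum_of_nonneg (fun _ => by positivity) hc]
  congr 1 with j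
  rw [ENNReal.ofReal_pow (norm_nonneg _), ofReal_norm]

theorem memℓp_two_iff {c : J → ℂ} : Memℓp c 2 ↔ Summable fun j => ‖c j‖ ^ 2 := by
  rw [memℓp_gen_iff (by norm_num)]
  simp

theorem norm_sq_eq_tsum (c : lp (fun _ : J => ℂ) 2) : ‖c‖ ^ 2 = ∑' j, ‖c j‖ ^ 2 := by
  have := lp.norm_rpow_eq_tsum (p := 2) (by norm_num) c
  simpa using this

theorem IsBessel.summable (h : IsBessel e B) (ξ : H) :
    Summable fun j => ‖inner ℂ (e j) ξ‖ ^ 2 :=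
  tsum_enorm_sq_lt_top_iff.1 ((h ξ).trans_lt ENNReal.ofReal_lt_top).ne

/-- The finite form of the Bessel condition is the one that survives limits of point sets. -/
theorem isBessel_iff (hB : 0 ≤ B) : IsBessel e B ↔
    ∀ (F : Finset J) (ξ : H), ∑ j ∈ F, ‖inner ℂ (e j) ξ‖ ^ 2 ≤ B * ‖ξ‖ ^ 2 := by
  have key : ∀ (F : Finset J) (ξ : H), ∑ j ∈ F, ‖inner ℂ (e j) ξ‖ₑ ^ 2 =
      ENNReal.ofReal (∑ j ∈ F, ‖inner ℂ (e j) ξ‖ ^ 2) := by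
    intro F ξ
    rw [ENNReal.ofReal_sum_of_nonneg (fun _ _ => by positivity)]
    refine Finset.sum_congr rfl fun j _ => ?_
    rw [ENNReal.ofReal_pow (norm_nonneg _), ofReal_norm]
  constructor
  · intro h F ξ
    rw [← ENNReal.ofReal_le_ofReal_iff (by positivity), ← key]
    exact (ENNReal.sum_le_tsum F).trans (h ξ)
  · intro h ξ
    rw [ENNReal.tsum_eq_iSup_sum]
    refine iSup_le fun F => ?_
    rw [key]
    exact ENNReal.ofReal_le_ofReal (h F ξ)

variable [CompleteSpace H]

open Classical in
/-- The analysis operator `ξ ↦ (⟨e j, ξ⟩)_j` of a Bessel family (and `0` otherwise). -/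
def analysisOp (e : J → H) : H →L[ℂ] lp (fun _ : J => ℂ) 2 :=
  if h : ∃ B, IsBessel e B then
    LinearMap.mkContinuous
      { toFun := fun ξ => ⟨fun j => inner ℂ (e j) ξ, memℓp_two_iff.2 (h.choose_spec.summable ξ)⟩
        map_add' := fun ξ ζ => by ext j; exact inner_add_right _ _ _
        map_smul' := fun c ξ => by ext j; exact inner_smul_right _ _ _ }
      -- The chosen bound may be negative, for instance for a family of zero vectors.
      (Real.sqrt (max h.choose 0)) fun ξ => by
        refine abs_le_of_sq_le_sq' ?_ (by positivity) |>.2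
        rw [norm_sq_eq_tsum, mul_pow, Real.sq_sqrt (le_max_right _ _)]
        refine Summable.tsum_le_of_sum_le (h.choose_spec.summable ξ) fun F => ?_
        refine (isBessel_iff (le_max_right _ _)).1 (fun ξ => ?_) F ξ
        refine (h.choose_spec ξ).trans (ENNReal.ofReal_le_ofReal ?_)
        gcongr
        exact le_max_left _ _
  else 0

theorem IsBessel.analysisOp_apply (h : IsBessel e B) (ξ : H) (j : J) :
    analysisOp e ξ j = inner ℂ (e j) ξ := by
  rw [analysisOp, dif_pos ⟨B, h⟩]
  rfl

theorem IsBessel.norm_analysisOp_sq (h : IsBessel e B) (ξ : H) :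
    ENNReal.ofReal (‖analysisOp e ξ‖ ^ 2) = ∑' j, ‖inner ℂ (e j) ξ‖ₑ ^ 2 := by
  rw [norm_sq_eq_tsum, tsum_enorm_sq_eq (h.summable ξ)]
  simp_rw [h.analysisOp_apply]

theorem IsBessel.norm_analysisOp_sq_le (h : IsBessel e B) (hB : 0 ≤ B) (ξ : H) :
    ‖analysisOp e ξ‖ ^ 2 ≤ B * ‖ξ‖ ^ 2 := by
  rw [← ENNReal.ofReal_le_ofReal_iff (by positivity), h.norm_analysisOp_sq]
  exact h ξ

/-- The frame operator of a Bessel family. -/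
def frameOp (e : J → H) : H →L[ℂ] H := ContinuousLinearMap.adjoint (analysisOp e) ∘L analysisOp e

open Classical in
theorem IsBessel.adjoint_analysisOp_single (h : IsBessel e B) (j : J) (a : ℂ) :
    ContinuousLinearMap.adjoint (analysisOp e) (lp.single 2 j a) = a • e j := by
  refine ext_inner_right ℂ fun ξ => ?_
  rw [ContinuousLinearMap.adjoint_inner_left, lp.inner_single_left, h.analysisOp_apply,
    inner_smul_left]
  simp [mul_comm]

theorem IsBessel.hasSum_adjoint_analysisOp (h : IsBessel e B) (c : lp (fun _ : J => ℂ) 2) :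
    HasSum (fun j => c j • e j) (ContinuousLinearMap.adjoint (analysisOp e) c) := by
  classical
  have := (lp.hasSum_single ENNReal.ofNat_ne_top c).mapL
    (ContinuousLinearMap.adjoint (analysisOp e))
  simpa only [h.adjoint_analysisOp_single] using this

theorem IsBessel.hasSum_frameOp (h : IsBessel e B) (ξ : H) :
    HasSum (fun j => (inner ℂ (e j) ξ : ℂ) • e j) (frameOp e ξ) := by
  have := h.hasSum_adjoint_analysisOp (analysisOp e ξ)
  simp only [h.analysisOp_apply] at this
  exact this

theorem IsBessel.hasSum_inner_frameOp (h : IsBessel e B) (ξ ζ : H) :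
    HasSum (fun j => inner ℂ ξ (e j) * inner ℂ (e j) ζ) (inner ℂ ξ (frameOp e ζ)) := by
  have := (h.hasSum_frameOp ζ).mapL (innerSL ℂ ξ)
  simpa [inner_smul_right, mul_comm] using this

/-- The lower Riesz bound extends from finite families of coefficients to `ℓ²`. -/
theorem IsBessel.le_norm_adjoint_analysisOp_sq (h : IsBessel e B) {A : ℝ}
    (hA : ∀ (F : Finset J) (c : J → ℂ), A * ∑ j ∈ F, ‖c j‖ ^ 2 ≤ ‖∑ j ∈ F, c j • e j‖ ^ 2)
    (c : lp (fun _ : J => ℂ) 2) :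
    A * ‖c‖ ^ 2 ≤ ‖ContinuousLinearMap.adjoint (analysisOp e) c‖ ^ 2 := by
  have h1 : HasSum (fun j => ‖c j‖ ^ 2) (‖c‖ ^ 2) := by
    rw [norm_sq_eq_tsum]
    exact (memℓp_two_iff.1 (lp.memℓp c)).hasSum
  exact le_of_tendsto_of_tendsto (Filter.Tendsto.const_mul A h1)
    ((h.hasSum_adjoint_analysisOp c).norm.pow 2) (Filter.Eventually.of_forall fun F => hA F c)

/-- The vectors of a Riesz sequence form a Bessel family. -/
theorem isBessel_of_norm_sum_le (hB : 0 ≤ B)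
    (h : ∀ (F : Finset J) (c : J → ℂ), ‖∑ j ∈ F, c j • e j‖ ^ 2 ≤ B * ∑ j ∈ F, ‖c j‖ ^ 2) :
    IsBessel e B := by
  rw [isBessel_iff hB]
  intro F ξ
  set s := ∑ j ∈ F, ‖inner ℂ (e j) ξ‖ ^ 2 with hs
  have hs0 : 0 ≤ s := Finset.sum_nonneg fun _ _ => by positivity
  -- The synthesis bound is tested on the coefficients `⟨e j, ξ⟩` themselves: their synthesis pairs
  -- with `ξ` to `s`, and after Cauchy–Schwarz one factor `s` cancels.
  have h1 : ‖inner ℂ (∑ j ∈ F, (inner ℂ (e j) ξ : ℂ) • e j) ξ‖ = s := by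
    rw [sum_inner]
    simp_rw [inner_smul_left, RCLike.conj_mul]
    have : ((s : ℝ) : ℂ) = ∑ j ∈ F, ((‖inner ℂ (e j) ξ‖ : ℝ) : ℂ) ^ 2 := by rw [hs]; push_cast; rfl
    refine (congrArg norm this.symm).trans ?_
    simpa using hs0
  have h2 := norm_inner_le_norm (𝕜 := ℂ) (∑ j ∈ F, (inner ℂ (e j) ξ : ℂ) • e j) ξ
  rw [h1] at h2
  have h3 := h F fun j => inner ℂ (e j) ξ
  have h4 : s ^ 2 ≤ B * s * ‖ξ‖ ^ 2 := by
    calc s ^ 2 ≤ (‖∑ j ∈ F, (inner ℂ (e j) ξ : ℂ) • e j‖ * ‖ξ‖) ^ 2 := by gcongr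
      _ ≤ B * s * ‖ξ‖ ^ 2 := by rw [mul_pow]; gcongr
  rcases hs0.eq_or_lt with h0 | h0
  · rw [← h0]; positivity
  · nlinarith

theorem IsRieszSequence.exists_bounds (h : IsRieszSequence e) :
    ∃ A B : ℝ, 0 < A ∧ A ≤ B ∧ IsBessel e B ∧
      ∀ (F : Finset J) (c : J → ℂ), A * ∑ j ∈ F, ‖c j‖ ^ 2 ≤ ‖∑ j ∈ F, c j • e j‖ ^ 2 := by
  classical
  obtain ⟨A, B, hA, hB, h⟩ := h
  have key : ∀ (F : Finset J) (c : J → ℂ), A * ∑ j ∈ F, ‖c j‖ ^ 2 ≤ ‖∑ j ∈ F, c j • e j‖ ^ 2 ∧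
      ‖∑ j ∈ F, c j • e j‖ ^ 2 ≤ B * ∑ j ∈ F, ‖c j‖ ^ 2 := by
    intro F c
    have hsup : ∀ j ∉ F, (if j ∈ F then c j else 0) = 0 := fun j hj => if_neg hj
    have hmem : Memℓp (fun j => if j ∈ F then c j else 0) 2 :=
      memℓp_two_iff.2 (summable_of_ne_finset_zero (s := F) fun j hj => by simp [hj])
    obtain ⟨-, h1, h2⟩ := h ⟨_, hmem⟩
    rw [norm_sq_eq_tsum] at h1 h2
    change _ * ∑' j, ‖if j ∈ F then c j else 0‖ ^ 2 ≤ ‖∑' j, (if j ∈ F then c j else 0) • e j‖ ^ 2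
      at h1
    change ‖∑' j, (if j ∈ F then c j else 0) • e j‖ ^ 2 ≤ _ * ∑' j, ‖if j ∈ F then c j else 0‖ ^ 2
      at h2
    rw [tsum_eq_sum (s := F) (fun j hj => by simp [hj]),
      tsum_eq_sum (s := F) (fun j hj => by simp [hj])] at h1 h2
    rw [Finset.sum_congr rfl (g := fun j => ‖c j‖ ^ 2) (fun j hj => by simp [hj]),
      Finset.sum_congr rfl (g := fun j => c j • e j) (fun j hj => by simp [hj])] at h1 h2
    exact ⟨h1, h2⟩
  -- Over an empty index set the given constants need not satisfy `A ≤ B`; the minimum restores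
  -- this.
  refine ⟨min A B, B, lt_min hA hB, min_le_right _ _,
    isBessel_of_norm_sum_le hB.le fun F c => (key F c).2, fun F c => le_trans ?_ (key F c).1⟩
  gcongr
  exact min_le_left _ _

end Bessel

/-! ### Orthogonality relations -/

/-- Right invariance of `m` makes its image under inversion left invariant, hence equal to `c • m`.
Inverting twice gives `c ^ 2 = 1`. -/
theorem isInvInvariant_of_isMulRightInvariant {G : Type*} [Group G] [TopologicalSpace G]
    [IsTopologicalGroup G] [LocallyCompactSpace G] [SecondCountableTopology G]
    [MeasurableSpace G] [BorelSpace G] (m : Measure G) [m.IsHaarMeasure]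
    [m.IsMulRightInvariant] : m.IsInvInvariant := by
  constructor
  let c : ℝ≥0∞ := Measure.haarScalarFactor m.inv m
  have hc : m.inv = c • m := Measure.isMulLeftInvariant_eq_smul m.inv m
  have h1 : Measure.map Inv.inv (Measure.map Inv.inv m) = c ^ 2 • m := by
    rw [← Measure.inv_def m, hc, Measure.map_smul, ← Measure.inv_def m, hc, smul_smul, pow_two]
  have meq : m = c ^ 2 • m := by
    rw [Measure.map_map continuous_inv.measurable continuous_inv.measurable] at h1
    simpa only [inv_involutive, Function.Involutive.comp_self, Measure.map_id] using h1
  have K : TopologicalSpace.PositiveCompacts G := Classical.arbitrary _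
  have h2 : c ^ 2 * m K = 1 ^ 2 * m K := by
    conv_rhs => rw [meq]
    simp
  have h3 : c ^ 2 = 1 ^ 2 :=
    (ENNReal.mul_left_inj (Measure.measure_pos_of_nonempty_interior _ K.interior_nonempty).ne'
      K.isCompact.measure_lt_top.ne).1 h2
  have h4 : c = 1 := (ENNReal.pow_right_strictMono two_ne_zero).injective h3
  rw [hc, h4, one_smul]

/-- A sesquilinear form that vanishes on the diagonal is zero. -/
theorem sesquilinear_eq_zero_of_diag {E : Type*} [AddCommGroup E] [Module ℂ E] (D : E → E → ℂ)
    (add_left : ∀ x y z, D (x + y) z = D x z + D y z)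
    (add_right : ∀ x y z, D x (y + z) = D x y + D x z)
    (smul_left : ∀ (c : ℂ) x y, D (c • x) y = conj c * D x y)
    (smul_right : ∀ (c : ℂ) x y, D x (c • y) = c * D x y)
    (diag : ∀ x, D x x = 0) (x y : E) : D x y = 0 := by
  have h1 := diag (x + y)
  have h2 := diag (x + Complex.I • y)
  rw [add_left, add_right, add_right, diag, diag] at h1
  rw [add_left, add_right, add_right, smul_left, smul_left, smul_right, smul_right, diag, diag,
    Complex.conj_I] at h2
  have h3 : Complex.I * (D x y - D y x) = 0 := by linear_combination h2
  rw [mul_eq_zero, or_iff_right Complex.I_ne_zero] at h3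
  linear_combination (h1 + h3) / 2

namespace ProjRep

variable {G : Type*} [Group G] [TopologicalSpace G] {σ : Cocycle G}
  {H : Type*} [NormedAddCommGroup H] [InnerProductSpace ℂ H]

theorem toFun_one (π : ProjRep σ H) (ξ : H) : π.toFun 1 ξ = ξ := by
  have := π.map_mul 1 1 ξ
  rw [σ.map_one_one, Circle.coe_one, one_smul, mul_one] at this
  exact (π.toFun 1).injective this

theorem conj_mul_self (z : Circle) : conj (z : ℂ) * z = 1 := by
  rw [mul_comm, Complex.mul_conj, Circle.normSq_coe, Complex.ofReal_one]

theorem toFun_mul (π : ProjRep σ H) (x y : G) (ξ : H) :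
    π.toFun (x * y) ξ = conj (σ.toFun x y : ℂ) • π.toFun x (π.toFun y ξ) := by
  rw [π.map_mul, smul_smul, conj_mul_self, one_smul]

/-- Acting on `ξ` translates the coefficient up to a phase; the phase disappears from moduli and
from products with a conjugate. -/
theorem coeff_smul_left (π : ProjRep σ H) (η ξ : H) (y x : G) :
    π.coeff η (π.toFun y ξ) (y * x) = σ.toFun y x * π.coeff η ξ x := by
  rw [coeff, toFun_mul, inner_smul_left, LinearIsometryEquiv.inner_map_map, Complex.conj_conj,
    coeff]

theorem norm_coeff_inv (π : ProjRep σ H) (η ξ : H) (x : G) :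
    ‖π.coeff η ξ x⁻¹‖ = ‖π.coeff ξ η x‖ := by
  have h := π.coeff_smul_left η ξ x x⁻¹
  rw [mul_inv_cancel, coeff, toFun_one] at h
  have h2 : ‖π.coeff ξ η x‖ = ‖inner ℂ η (π.toFun x ξ)‖ := norm_inner_symm _ _
  rw [h2, h, norm_mul, Circle.norm_coe, one_mul]

theorem continuous_coeff (π : ProjRep σ H) (η ξ : H) : Continuous (π.coeff η ξ) :=
  (π.strongly_continuous η).inner continuous_const

theorem coeff_add (π : ProjRep σ H) (η ξ ζ : H) :
    π.coeff η (ξ + ζ) = π.coeff η ξ + π.coeff η ζ :=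
  funext fun _ => inner_add_right _ _ _

theorem coeff_smul (π : ProjRep σ H) (c : ℂ) (η ξ : H) :
    π.coeff η (c • ξ) = c • π.coeff η ξ :=
  funext fun _ => inner_smul_right _ _ _

/-- A bounded self-adjoint operator that commutes with an irreducible representation is scalar. -/
theorem IsIrreducible.exists_eq_smul_one [CompleteSpace H] {π : ProjRep σ H}
    (hπ : π.IsIrreducible) {A : H →L[ℂ] H} (hA : IsSelfAdjoint A)
    (hcomm : ∀ x ξ, A (π.toFun x ξ) = π.toFun x (A ξ)) : ∃ c : ℝ, A = algebraMap ℝ _ c := by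
  have := hπ.1
  have hne : (spectrum ℝ A).Nonempty := ContinuousFunctionalCalculus.spectrum_nonempty A hA
  obtain ⟨a, ha⟩ := hne
  refine ⟨a, CFC.eq_algebraMap_of_spectrum_subset_singleton A a ?_ hA⟩
  by_contra hsub
  obtain ⟨b, hb, hba⟩ := Set.not_subset.1 hsub
  rw [mem_singleton_iff] at hba
  wlog hab : a < b generalizing a b
  · exact this b hb (fun h => hba (mem_singleton_iff.1 (h ha)).symm) a ha (Ne.symm hba)
      (lt_of_le_of_ne (not_lt.1 hab) hba)
  -- Two spectral points are separated by functions `f` and `g` with `f g = 0`. Both `f(A)` and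
  -- `g(A)` are nonzero, and the kernel of `f(A)` is closed, invariant, proper, and contains the
  -- range of `g(A)`, against irreducibility.
  set c := (a + b) / 2 with hc
  set f : ℝ → ℝ := fun x => max (x - c) 0 with hf
  set g : ℝ → ℝ := fun x => max (c - x) 0 with hg
  have hfc : Continuous f := by fun_prop
  have hgc : Continuous g := by fun_prop
  have hfA : cfc f A ≠ 0 := by
    intro h0
    have h1 := cfc_map_spectrum f A hA hfc.continuousOn
    have h2 : f b ∈ spectrum ℝ (cfc f A) := h1 ▸ mem_image_of_mem f hb
    rw [h0, spectrum.zero_eq, mem_singleton_iff, hf] at h2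
    simp only [max_eq_right_iff] at h2
    linarith
  have hgA : cfc g A ≠ 0 := by
    intro h0
    have h1 := cfc_map_spectrum g A hA hgc.continuousOn
    have h2 : g a ∈ spectrum ℝ (cfc g A) := h1 ▸ mem_image_of_mem g ha
    rw [h0, spectrum.zero_eq, mem_singleton_iff, hg] at h2
    simp only [max_eq_right_iff] at h2
    linarith
  have hfg : cfc f A * cfc g A = 0 := by
    rw [← cfc_mul f g A hfc.continuousOn hgc.continuousOn, show (fun x => f x * g x) = fun _ => 0
      from funext fun x => ?_, cfc_const_zero]
    rcases le_total x c with h | h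
    · simp [hf, sub_nonpos.2 h]
    · simp [hg, sub_nonpos.2 h]
  have hcf : ∀ x ξ, cfc f A (π.toFun x ξ) = π.toFun x (cfc f A ξ) := by
    intro x ξ
    let u : H →L[ℂ] H := (π.toFun x).toContinuousLinearEquiv.toContinuousLinearMap
    have hu : Commute A u := ContinuousLinearMap.ext fun ζ => hcomm x ζ
    exact DFunLike.congr_fun (hu.cfc_real f).eq ξ
  rcases hπ.2 (LinearMap.ker (cfc f A : H →L[ℂ] H).toLinearMap) (cfc f A).isClosed_ker
    (fun x ξ hξ => by
      rw [LinearMap.mem_ker] at hξ ⊢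
      exact (hcf x ξ).trans (by rw [show cfc f A ξ = 0 from hξ, map_zero])) with h | h
  · refine hgA (ContinuousLinearMap.ext fun ξ => ?_)
    have : cfc g A ξ ∈ LinearMap.ker (cfc f A : H →L[ℂ] H).toLinearMap :=
      LinearMap.mem_ker.2 (DFunLike.congr_fun hfg ξ)
    rwa [h, Submodule.mem_bot] at this
  · refine hfA (ContinuousLinearMap.ext fun ξ => ?_)
    have : ξ ∈ LinearMap.ker (cfc f A : H →L[ℂ] H).toLinearMap := h ▸ Submodule.mem_top
    exact LinearMap.mem_ker.1 this

variable [MeasurableSpace G] [BorelSpace G] {m : Measure G}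

theorem memLp_coeff_iff (π : ProjRep σ H) (η ξ : H) :
    MemLp (π.coeff η ξ) 2 m ↔ ∫⁻ x, ‖π.coeff η ξ x‖ₑ ^ 2 ∂m < ∞ := by
  rw [MemLp, and_iff_right (π.continuous_coeff η ξ).aestronglyMeasurable,
    eLpNorm_lt_top_iff_lintegral_rpow_enorm_lt_top (by norm_num) (by norm_num)]
  simp

variable [IsTopologicalGroup G]

theorem memLp_coeff_toFun_iff [m.IsMulLeftInvariant] (π : ProjRep σ H) (η ξ : H) (y : G) :
    MemLp (π.coeff η (π.toFun y ξ)) 2 m ↔ MemLp (π.coeff η ξ) 2 m := by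
  rw [memLp_coeff_iff, memLp_coeff_iff, ← lintegral_mul_left_eq_self _ y]
  have : ∀ z : Circle, ‖(z : ℂ)‖ₑ = 1 := fun z => by
    rw [← ofReal_norm, Circle.norm_coe, ENNReal.ofReal_one]
  simp_rw [coeff_smul_left, enorm_mul, this, one_mul]

theorem lintegral_coeff_symm [m.IsInvInvariant] (π : ProjRep σ H) (η ξ : H) :
    ∫⁻ x, ‖π.coeff η ξ x‖ₑ ^ 2 ∂m = ∫⁻ x, ‖π.coeff ξ η x‖ₑ ^ 2 ∂m := by
  rw [← lintegral_inv_eq_self]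
  refine lintegral_congr fun x => ?_
  rw [← ofReal_norm, norm_coeff_inv, ofReal_norm]

/-- The graph of the coefficient operator `ξ ↦ ⟨ξ, π(·) η⟩` on its natural domain. -/
def coeffGraph (π : ProjRep σ H) (m : Measure G) (η : H) :
    Submodule ℂ (WithLp 2 (H × Lp ℂ 2 m)) where
  carrier := {p | p.snd =ᵐ[m] π.coeff η p.fst}
  zero_mem' := by
    show ((0 : Lp ℂ 2 m) : G → ℂ) =ᵐ[m] π.coeff η 0
    filter_upwards [Lp.coeFn_zero ℂ 2 m] with x hx
    rw [hx]; exact (inner_zero_right _).symm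
  add_mem' := by
    intro p q (hp : p.snd =ᵐ[m] π.coeff η p.fst) (hq : q.snd =ᵐ[m] π.coeff η q.fst)
    show ((p.snd + q.snd : Lp ℂ 2 m) : G → ℂ) =ᵐ[m] π.coeff η (p.fst + q.fst)
    rw [coeff_add]
    exact (Lp.coeFn_add _ _).trans (hp.add hq)
  smul_mem' := by
    intro c p (hp : p.snd =ᵐ[m] π.coeff η p.fst)
    show ((c • p.snd : Lp ℂ 2 m) : G → ℂ) =ᵐ[m] π.coeff η (c • p.fst)
    rw [coeff_smul]
    exact (Lp.coeFn_smul _ _).trans (hp.const_smul c)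

/-- An `L²`-convergent sequence has a subsequence converging almost everywhere, and coefficients
depend continuously on `ξ` at each point. Thus the graph is a Hilbert space before its domain is
known to be all of `H`. -/
theorem isClosed_coeffGraph (π : ProjRep σ H) (m : Measure G) (η : H) :
    IsClosed (π.coeffGraph m η : Set (WithLp 2 (H × Lp ℂ 2 m))) := by
  refine isClosed_of_closure_subset fun p hp => ?_
  obtain ⟨u, hu, hlim⟩ := mem_closure_iff_seq_limit.1 hp
  have h1 : Filter.Tendsto (fun n => (u n).fst) Filter.atTop (𝓝 p.fst) :=
    ((WithLp.fstL 2 ℂ H (Lp ℂ 2 m)).continuous.tendsto p).comp hlim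
  have h2 : Filter.Tendsto (fun n => (u n).snd) Filter.atTop (𝓝 p.snd) :=
    ((WithLp.sndL 2 ℂ H (Lp ℂ 2 m)).continuous.tendsto p).comp hlim
  obtain ⟨ns, hns, hae⟩ := (tendstoInMeasure_of_tendsto_Lp h2).exists_seq_tendsto_ae
  show p.snd =ᵐ[m] π.coeff η p.fst
  have hall : ∀ᵐ x ∂m, ∀ n, (u n).snd x = π.coeff η (u n).fst x := ae_all_iff.2 hu
  filter_upwards [hae, hall] with x hx hx'
  refine tendsto_nhds_unique hx ?_
  simp_rw [hx']
  exact (((continuous_const.inner continuous_id).tendsto p.fst).comp h1).comp hns.tendsto_atTop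

/-- The element of the graph over a vector with square integrable coefficient. -/
def graphMk (π : ProjRep σ H) (m : Measure G) (η ξ : H) (h : MemLp (π.coeff η ξ) 2 m) :
    π.coeffGraph m η :=
  ⟨WithLp.toLp 2 (ξ, h.toLp _), h.coeFn_toLp⟩

theorem memLp_of_mem_coeffGraph {π : ProjRep σ H} {η : H} (p : π.coeffGraph m η) :
    MemLp (π.coeff η p.1.fst) 2 m :=
  (memLp_congr_ae p.2).1 (Lp.memLp p.1.snd)

theorem eq_graphMk {π : ProjRep σ H} {η : H} (p : π.coeffGraph m η) :
    p = π.graphMk m η p.1.fst (memLp_of_mem_coeffGraph p) := by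
  refine Subtype.ext (WithLp.ofLp_injective 2 (Prod.ext rfl (Lp.ext ?_)))
  exact Filter.EventuallyEq.trans (show p.1.snd =ᵐ[m] π.coeff η p.1.fst from p.2)
    (MemLp.coeFn_toLp (memLp_of_mem_coeffGraph p)).symm

theorem inner_graphMk (π : ProjRep σ H) (η ξ ζ : H) (h : MemLp (π.coeff η ξ) 2 m)
    (h' : MemLp (π.coeff η ζ) 2 m) :
    inner ℂ (π.graphMk m η ξ h) (π.graphMk m η ζ h') =
      inner ℂ ξ ζ + ∫ x, inner ℂ (π.coeff η ξ x) (π.coeff η ζ x) ∂m := by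
  refine (WithLp.prod_inner_apply _ _).trans (congrArg _ ?_)
  rw [L2.inner_def]
  refine integral_congr_ae ?_
  filter_upwards [h.coeFn_toLp, h'.coeFn_toLp] with x hx hx'
  exact congrArg₂ _ hx hx'

theorem inner_graphMk_toFun [m.IsMulLeftInvariant] (π : ProjRep σ H) (η ξ ζ : H) (y : G)
    (h : MemLp (π.coeff η ξ) 2 m) (h' : MemLp (π.coeff η ζ) 2 m) :
    inner ℂ (π.graphMk m η (π.toFun y ξ) ((π.memLp_coeff_toFun_iff η ξ y).2 h))
      (π.graphMk m η (π.toFun y ζ) ((π.memLp_coeff_toFun_iff η ζ y).2 h')) =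
    inner ℂ (π.graphMk m η ξ h) (π.graphMk m η ζ h') := by
  rw [inner_graphMk, inner_graphMk, LinearIsometryEquiv.inner_map_map,
    ← integral_mul_left_eq_self _ y]
  congr 2
  ext x
  rw [coeff_smul_left, coeff_smul_left, ← smul_eq_mul, ← smul_eq_mul, inner_smul_left,
    inner_smul_right, ← mul_assoc, conj_mul_self, one_mul]

variable [CompleteSpace H]

/-- If the coefficient operator of `η` is defined at some nonzero vector, then it is everywhere
defined and a multiple of an isometry. -/
theorem IsIrreducible.exists_norm_coeff_eq [m.IsMulLeftInvariant] {π : ProjRep σ H}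
    (hπ : π.IsIrreducible) {η ξ₀ : H} (h0 : ξ₀ ≠ 0) (h : MemLp (π.coeff η ξ₀) 2 m) :
    (∀ ξ, MemLp (π.coeff η ξ) 2 m) ∧
      ∃ a : ℝ, ∀ ξ, ∫ x, ‖π.coeff η ξ x‖ ^ 2 ∂m = a * ‖ξ‖ ^ 2 := by
  have : CompleteSpace (π.coeffGraph m η) := (π.isClosed_coeffGraph m η).completeSpace_coe
  -- `T` projects the graph to `H`. Since `T T*` commutes with `π`, it is a scalar `c`, and `c ≠ 0`
  -- because the graph has a point over `ξ₀ ≠ 0`. Then `c⁻¹ T* ξ` lies over `ξ`, so the domain is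
  -- everything, and its squared graph norm `c⁻¹ ‖ξ‖²` leaves `(c⁻¹ - 1) ‖ξ‖²` for the `L²` part.
  let T : π.coeffGraph m η →L[ℂ] H :=
    (WithLp.fstL 2 ℂ H (Lp ℂ 2 m)).comp (π.coeffGraph m η).subtypeL
  have hT : ∀ p, T p = p.1.fst := fun _ => rfl
  have hcomm : ∀ x ξ, (T ∘L ContinuousLinearMap.adjoint T) (π.toFun x ξ) =
      π.toFun x ((T ∘L ContinuousLinearMap.adjoint T) ξ) := by
    intro y ξ
    set p := ContinuousLinearMap.adjoint T ξ with hp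
    have hmem := memLp_of_mem_coeffGraph p
    suffices hq : π.graphMk m η (π.toFun y p.1.fst) ((π.memLp_coeff_toFun_iff η _ y).2 hmem) =
        ContinuousLinearMap.adjoint T (π.toFun y ξ) by
      show T (ContinuousLinearMap.adjoint T (π.toFun y ξ)) = _
      rw [← hq]
      rfl
    -- Equivariance of `T*` is tested against the graph, on which translation preserves inner
    -- products.
    refine ext_inner_left ℂ fun q => ?_
    rw [ContinuousLinearMap.adjoint_inner_right, hT]
    obtain ⟨ε, hε⟩ := (π.toFun y).surjective q.1.fst
    have hqm := memLp_of_mem_coeffGraph q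
    rw [eq_graphMk q]
    simp only [← hε] at hqm ⊢
    rw [inner_graphMk_toFun π η ε p.1.fst y ((π.memLp_coeff_toFun_iff η ε y).1 hqm) hmem,
      ← eq_graphMk p, hp, ContinuousLinearMap.adjoint_inner_right, hT]
    exact ((π.toFun y).inner_map_map ε ξ).symm
  obtain ⟨c, hc⟩ := hπ.exists_eq_smul_one
    (ContinuousLinearMap.isPositive_self_comp_adjoint T).isSelfAdjoint hcomm
  have hc' : ∀ ξ, T (ContinuousLinearMap.adjoint T ξ) = (c : ℂ) • ξ := fun ξ => by
    have := DFunLike.congr_fun hc ξ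
    rw [Algebra.algebraMap_eq_smul_one] at this
    exact this.trans (Complex.coe_smul c ξ).symm
  have hc0 : (c : ℂ) ≠ 0 := by
    intro hcz
    have h1 : ∀ ξ, ContinuousLinearMap.adjoint T ξ = 0 := fun ξ => by
      rw [← inner_self_eq_zero (𝕜 := ℂ), ContinuousLinearMap.adjoint_inner_left, hc', hcz, zero_smul,
        inner_zero_right]
    have h2 : inner ℂ (ContinuousLinearMap.adjoint T ξ₀) (π.graphMk m η ξ₀ h) = inner ℂ ξ₀ ξ₀ :=
      ContinuousLinearMap.adjoint_inner_left _ _ _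
    rw [h1, inner_zero_left] at h2
    exact h0 (inner_self_eq_zero.1 h2.symm)
  have hfst : ∀ ξ, ((c : ℂ)⁻¹ • ContinuousLinearMap.adjoint T ξ).1.fst = ξ := fun ξ => by
    rw [← hT, map_smul, hc', smul_smul, inv_mul_cancel₀ hc0, one_smul]
  have hmem : ∀ ξ, MemLp (π.coeff η ξ) 2 m := fun ξ => by
    have := memLp_of_mem_coeffGraph ((c : ℂ)⁻¹ • ContinuousLinearMap.adjoint T ξ)
    rwa [hfst] at this
  refine ⟨hmem, c⁻¹ - 1, fun ξ => ?_⟩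
  have h1 : π.graphMk m η ξ (hmem ξ) = (c : ℂ)⁻¹ • ContinuousLinearMap.adjoint T ξ := by
    rw [eq_graphMk ((c : ℂ)⁻¹ • ContinuousLinearMap.adjoint T ξ)]
    simp only [hfst]
  have h2 : inner ℂ (π.graphMk m η ξ (hmem ξ)) (π.graphMk m η ξ (hmem ξ)) =
      (c : ℂ)⁻¹ * ((‖ξ‖ ^ 2 : ℝ) : ℂ) := by
    have h3 : inner ℂ (π.graphMk m η ξ (hmem ξ)) (ContinuousLinearMap.adjoint T ξ) =
      ((‖ξ‖ ^ 2 : ℝ) : ℂ) := by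
      rw [ContinuousLinearMap.adjoint_inner_right]
      refine (inner_self_eq_norm_sq_to_K ξ).trans ?_
      push_cast; rfl
    rw [← h3]
    nth_rewrite 2 [h1]
    exact inner_smul_right (𝕜 := ℂ) (π.graphMk m η ξ (hmem ξ)) (ContinuousLinearMap.adjoint T ξ) _
  have h3 : ∫ x, inner ℂ (π.coeff η ξ x) (π.coeff η ξ x) ∂m =
      ((∫ x, ‖π.coeff η ξ x‖ ^ 2 ∂m : ℝ) : ℂ) := by
    rw [← integral_complex_ofReal]
    refine integral_congr_ae (Filter.Eventually.of_forall fun x => ?_)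
    refine (inner_self_eq_norm_sq_to_K (𝕜 := ℂ) (π.coeff η ξ x)).trans ?_
    push_cast; rfl
  rw [π.inner_graphMk η ξ ξ (hmem ξ) (hmem ξ), h3, inner_self_eq_norm_sq_to_K] at h2
  have h4 : ((‖ξ‖ ^ 2 + ∫ x, ‖π.coeff η ξ x‖ ^ 2 ∂m : ℝ) : ℂ) =
      ((c⁻¹ * ‖ξ‖ ^ 2 : ℝ) : ℂ) := by
    push_cast
    simpa using h2
  have := Complex.ofReal_injective h4
  linarith

theorem inner_toLp_coeff (π : ProjRep σ H) {η ξ η' ξ' : H} (h : MemLp (π.coeff η ξ) 2 m)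
    (h' : MemLp (π.coeff η' ξ') 2 m) :
    inner ℂ (h'.toLp (π.coeff η' ξ')) (h.toLp (π.coeff η ξ)) =
      ∫ x, π.coeff η ξ x * conj (π.coeff η' ξ' x) ∂m := by
  rw [L2.inner_def]
  refine integral_congr_ae ?_
  filter_upwards [h.coeFn_toLp, h'.coeFn_toLp] with x hx hx'
  rw [hx, hx']
  rfl

/-- Discrete series representations of unimodular groups satisfy the orthogonality relations. -/
theorem IsDiscreteSeries.exists_isFormalDimension [m.IsMulLeftInvariant] [m.IsInvInvariant]
    [m.IsOpenPosMeasure] {π : ProjRep σ H} (hπ : π.IsDiscreteSeries m) :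
    ∃ d, π.IsFormalDimension m d := by
  obtain ⟨hirr, ξ₀, h0, hint⟩ := hπ
  have hn0 : ‖ξ₀‖ ≠ 0 := norm_ne_zero_iff.2 h0
  -- Inversion exchanges `η` and `ξ` in the modulus of a coefficient. Unimodularity thus lets square
  -- integrability spread from `(ξ₀, ξ₀)` to all `ξ`, and then to all `η`.
  have hsymm : ∀ η ξ, MemLp (π.coeff η ξ) 2 m → MemLp (π.coeff ξ η) 2 m := fun η ξ h => by
    rw [memLp_coeff_iff] at h ⊢
    rwa [lintegral_coeff_symm]
  have h1 := (hirr.exists_norm_coeff_eq h0 ((π.memLp_coeff_iff ξ₀ ξ₀).2 hint)).1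
  have hmem : ∀ η ξ, MemLp (π.coeff η ξ) 2 m := fun η =>
    (hirr.exists_norm_coeff_eq h0 (hsymm _ _ (h1 η))).1
  choose a ha using fun η => (hirr.exists_norm_coeff_eq h0 (hmem η ξ₀)).2
  have hcomm : ∀ η ξ, ∫ x, ‖π.coeff η ξ x‖ ^ 2 ∂m = ∫ x, ‖π.coeff ξ η x‖ ^ 2 ∂m := fun η ξ => by
    rw [← integral_inv_eq_self]
    simp_rw [norm_coeff_inv]
  -- Symmetry gives `a η * ‖ξ₀‖² = a ξ₀ * ‖η‖²`, so `a η = b ‖η‖²`; the formal dimension will be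
  -- `b⁻¹`.
  set b := a ξ₀ / ‖ξ₀‖ ^ 2 with hb
  have hnorm : ∀ η ξ, ∫ x, ‖π.coeff η ξ x‖ ^ 2 ∂m = b * ‖η‖ ^ 2 * ‖ξ‖ ^ 2 := fun η ξ => by
    have h2 := hcomm η ξ₀
    rw [ha, ha] at h2
    rw [ha, hb, div_mul_eq_mul_div, ← h2]
    field_simp
  have hbpos : 0 < b := by
    have h2 : 0 < ∫ x, ‖π.coeff ξ₀ ξ₀ x‖ ^ 2 ∂m := by
      have hcont : Continuous fun x => ‖π.coeff ξ₀ ξ₀ x‖ ^ 2 :=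
        (π.continuous_coeff ξ₀ ξ₀).norm.pow 2
      refine (integral_pos_iff_support_of_nonneg (fun x => by positivity)
        ((memLp_two_iff_integrable_sq_norm (hmem ξ₀ ξ₀).1).1 (hmem ξ₀ ξ₀))).2 ?_
      refine hcont.isOpen_support.measure_pos m ⟨1, ?_⟩
      rw [Function.mem_support, coeff, toFun_one]
      simpa using h0
    rw [hnorm] at h2
    by_contra hneg
    have : b * ‖ξ₀‖ ^ 2 * ‖ξ₀‖ ^ 2 ≤ 0 := by
      rw [mul_assoc]
      exact mul_nonpos_of_nonpos_of_nonneg (not_lt.1 hneg) (by positivity)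
    linarith
  have hself : ∀ η ξ, inner ℂ ((hmem η ξ).toLp (π.coeff η ξ)) ((hmem η ξ).toLp (π.coeff η ξ)) =
      (b : ℂ) * inner ℂ ξ ξ * inner ℂ η η := fun η ξ => by
    rw [inner_toLp_coeff, inner_self_eq_norm_sq_to_K, inner_self_eq_norm_sq_to_K]
    have : ∀ x, π.coeff η ξ x * conj (π.coeff η ξ x) = ((‖π.coeff η ξ x‖ ^ 2 : ℝ) : ℂ) := fun x => by
      rw [Complex.mul_conj, Complex.normSq_eq_norm_sq]
    simp_rw [this]
    rw [integral_complex_ofReal, hnorm]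
    push_cast
    show (b : ℂ) * (‖η‖ : ℂ) ^ 2 * (‖ξ‖ : ℂ) ^ 2 = b * (‖ξ‖ : ℂ) ^ 2 * (‖η‖ : ℂ) ^ 2
    ring
  have hadd : ∀ η ξ ζ, (hmem η (ξ + ζ)).toLp (π.coeff η (ξ + ζ)) =
      (hmem η ξ).toLp (π.coeff η ξ) + (hmem η ζ).toLp (π.coeff η ζ) := fun η ξ ζ => by
    rw [← MemLp.toLp_add]; exact MemLp.toLp_congr _ _ (by rw [coeff_add])
  have hsmul : ∀ (c : ℂ) η ξ, (hmem η (c • ξ)).toLp (π.coeff η (c • ξ)) =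
      c • (hmem η ξ).toLp (π.coeff η ξ) := fun c η ξ => by
    rw [← MemLp.toLp_const_smul]; exact MemLp.toLp_congr _ _ (by rw [coeff_smul])
  have hadd' : ∀ η η' ξ, (hmem (η + η') ξ).toLp (π.coeff (η + η') ξ) =
      (hmem η ξ).toLp (π.coeff η ξ) + (hmem η' ξ).toLp (π.coeff η' ξ) := fun η η' ξ => by
    rw [← MemLp.toLp_add]
    refine MemLp.toLp_congr _ _ (Filter.Eventually.of_forall fun x => ?_)
    exact (congrArg (inner ℂ · ξ) (map_add (π.toFun x) η η')).trans (inner_add_left _ _ _)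
  have hsmul' : ∀ (c : ℂ) η ξ, (hmem (c • η) ξ).toLp (π.coeff (c • η) ξ) =
      conj c • (hmem η ξ).toLp (π.coeff η ξ) := fun c η ξ => by
    rw [← MemLp.toLp_const_smul]
    refine MemLp.toLp_congr _ _ (Filter.Eventually.of_forall fun x => ?_)
    exact (congrArg (inner ℂ · ξ) (map_smul (π.toFun x) c η)).trans (inner_smul_left _ _ _)
  -- Polarization, here in `ξ` and below in `η`.
  have hpol : ∀ η ξ ξ', inner ℂ ((hmem η ξ').toLp (π.coeff η ξ')) ((hmem η ξ).toLp (π.coeff η ξ)) =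
      (b : ℂ) * inner ℂ ξ' ξ * inner ℂ η η := fun η ξ ξ' => by
    rw [← sub_eq_zero]
    refine sesquilinear_eq_zero_of_diag (fun ξ' ξ => inner ℂ ((hmem η ξ').toLp (π.coeff η ξ'))
      ((hmem η ξ).toLp (π.coeff η ξ)) - (b : ℂ) * inner ℂ ξ' ξ * inner ℂ η η) ?_ ?_ ?_ ?_ ?_ ξ' ξ
    · intro x y z; simp only [hadd, inner_add_left]; ring
    · intro x y z; simp only [hadd, inner_add_right]; ring
    · intro c x y; simp only [hsmul, inner_smul_left]; ring
    · intro c x y; simp only [hsmul, inner_smul_right]; ring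
    · intro x; simp only [hself, sub_self]
  refine ⟨b⁻¹, inv_pos.2 hbpos, fun ξ η => hmem η ξ, fun ξ ξ' η η' => ?_⟩
  rw [← inner_toLp_coeff π (hmem η ξ) (hmem η' ξ'), inner_conj_symm, Complex.ofReal_inv, inv_inv,
    ← sub_eq_zero]
  refine sesquilinear_eq_zero_of_diag (fun η η' => inner ℂ ((hmem η' ξ').toLp (π.coeff η' ξ'))
    ((hmem η ξ).toLp (π.coeff η ξ)) - (b : ℂ) * inner ℂ ξ' ξ * inner ℂ η η') ?_ ?_ ?_ ?_ ?_ η η'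
  · intro x y z; simp only [hadd', inner_add_left, inner_add_right]; ring
  · intro x y z; simp only [hadd', inner_add_left, inner_add_right]; ring
  · intro c x y; simp only [hsmul', inner_smul_left, inner_smul_right]; ring
  · intro c x y; simp only [hsmul', inner_smul_left, inner_smul_right, Complex.conj_conj]; ring
  · intro x; simp only [hpol, sub_self]

end ProjRep

/-! ### The Chabauty–Fell space -/

namespace ClosedSubsets

section Topology

variable {G : Type*} [TopologicalSpace G]

theorem isOpen_miss {K : Set G} (hK : IsCompact K) :
    IsOpen {C : ClosedSubsets G | C.carrier ∩ K = ∅} :=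
  TopologicalSpace.isOpen_generateFrom_of_mem (Or.inl ⟨K, hK, rfl⟩)

theorem isOpen_hit {V : Set G} (hV : IsOpen V) :
    IsOpen {C : ClosedSubsets G | (C.carrier ∩ V).Nonempty} :=
  TopologicalSpace.isOpen_generateFrom_of_mem (Or.inr ⟨V, hV, rfl⟩)

/-- By Alexander's theorem only subbasic covers matter. Let `V` be the union of the open sets whose
hit sets belong to the cover. The closed set `Vᶜ` hits none of them, so it lies in a miss set of
some compact `K`, whence `K ⊆ V`. Finitely many of the open sets cover `K`; their hit sets and the
miss set of `K` cover the space. -/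
instance : CompactSpace (ClosedSubsets G) := by
  refine ⟨isCompact_generateFrom rfl fun S hS hcov => ?_⟩
  set V : Set G := ⋃₀ {W | IsOpen W ∧ {C : ClosedSubsets G | (C.carrier ∩ W).Nonempty} ∈ S} with hV
  have hVo : IsOpen V := isOpen_sUnion fun W hW => hW.1
  obtain ⟨T, hTS, hT⟩ := hcov (mem_univ (⟨Vᶜ, hVo.isClosed_compl⟩ : ClosedSubsets G))
  rcases hS hTS with ⟨K, hK, rfl⟩ | ⟨W, hW, rfl⟩
  · have hKV : K ⊆ V := by
      intro x hx
      by_contra hxV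
      exact (Set.eq_empty_iff_forall_notMem.1 hT x) ⟨hxV, hx⟩
    obtain ⟨F, hF, hFfin, hKF⟩ := hK.elim_finite_subcover_image (c := id)
      (b := {W | IsOpen W ∧ {C : ClosedSubsets G | (C.carrier ∩ W).Nonempty} ∈ S})
      (fun W hW => hW.1) (by rwa [hV, Set.sUnion_eq_biUnion] at hKV)
    refine ⟨insert {C : ClosedSubsets G | C.carrier ∩ K = ∅}
      ((fun W => {C : ClosedSubsets G | (C.carrier ∩ W).Nonempty}) '' F), ?_,
      (hFfin.image _).insert _, fun C _ => ?_⟩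
    · rintro T (rfl | ⟨W, hW, rfl⟩)
      · exact hTS
      · exact (hF hW).2
    · by_cases hCK : C.carrier ∩ K = ∅
      · exact ⟨_, mem_insert _ _, hCK⟩
      · obtain ⟨x, hxC, hxK⟩ := Set.nonempty_iff_ne_empty.2 hCK
        obtain ⟨W, hWF, hxW⟩ := Set.mem_iUnion₂.1 (hKF hxK)
        exact ⟨_, mem_insert_of_mem _ ⟨W, hWF, rfl⟩, x, hxC, hxW⟩
  · obtain ⟨x, hxV, hxW⟩ := hT
    exact absurd (show x ∈ V from Set.mem_sUnion_of_mem hxW ⟨hW, hTS⟩) hxV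

variable [T2Space G] [LocallyCompactSpace G]

theorem exists_mem_countableBasis [SecondCountableTopology G] {C : Set G} (hC : IsClosed C) {x : G}
    (hx : x ∉ C) : ∃ V ∈ TopologicalSpace.countableBasis G, x ∈ V ∧ IsCompact (closure V) ∧
      closure V ∩ C = ∅ := by
  obtain ⟨L, hL, hxL, hLC⟩ := exists_compact_subset hC.isOpen_compl hx
  obtain ⟨V, hV, hxV, hVL⟩ :=
    (TopologicalSpace.isBasis_countableBasis G).exists_subset_of_mem_open hxL isOpen_interior
  have hcl : closure V ⊆ L := closure_minimal (hVL.trans interior_subset) hL.isClosed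
  exact ⟨V, hV, hxV, hL.of_isClosed_subset isClosed_closure hcl,
    Set.disjoint_iff_inter_eq_empty.1 (Set.disjoint_left.2 fun y hy => hLC (hcl hy))⟩

/-- It suffices to hit basic open sets and to miss finite unions of compact closures of basic open
sets. -/
instance [SecondCountableTopology G] : SecondCountableTopology (ClosedSubsets G) := by
  set b := TopologicalSpace.countableBasis G with hb
  have hbc : b.Countable := TopologicalSpace.countable_countableBasis G
  set s₁ : Set (Set (ClosedSubsets G)) :=
    (fun F : Set (Set G) => {C | C.carrier ∩ ⋃ V ∈ F, closure V = ∅}) ''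
      {F | F.Finite ∧ F ⊆ {V ∈ b | IsCompact (closure V)}} with hs₁
  set s₂ : Set (Set (ClosedSubsets G)) :=
    (fun V : Set G => {C | (C.carrier ∩ V).Nonempty}) '' b with hs₂
  have hcount : (s₁ ∪ s₂).Countable :=
    ((Set.countable_ofPred_finite_subset (hbc.mono (Set.sep_subset _ _))).image _).union (hbc.image _)
  refine ⟨⟨s₁ ∪ s₂, hcount, le_antisymm ?_ ?_⟩⟩
  · refine le_generateFrom ?_
    rintro _ (⟨F, ⟨hF, hFb⟩, rfl⟩ | ⟨V, hV, rfl⟩)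
    · exact isOpen_miss (hF.isCompact_biUnion fun V hV => (hFb hV).2)
    · exact isOpen_hit (TopologicalSpace.isOpen_of_mem_countableBasis hV)
  · refine le_generateFrom ?_
    rintro _ (⟨K, hK, rfl⟩ | ⟨V, hV, rfl⟩)
    · have : {C : ClosedSubsets G | C.carrier ∩ K = ∅} =
          ⋃₀ {S | S ∈ s₁ ∧ S ⊆ {C : ClosedSubsets G | C.carrier ∩ K = ∅}} := by
        refine Set.Subset.antisymm (fun C hC => ?_) (Set.sUnion_subset fun S hS => hS.2)
        have hloc : ∀ x : K, ∃ V ∈ b, (x : G) ∈ V ∧ IsCompact (closure V) ∧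
            closure V ∩ C.carrier = ∅ := fun x =>
          exists_mem_countableBasis C.isClosed
            fun hx => (Set.eq_empty_iff_forall_notMem.1 hC x) ⟨hx, x.2⟩
        choose V hVb hxV hVc hVC using hloc
        obtain ⟨t, ht⟩ := hK.elim_finite_subcover V
          (fun x => TopologicalSpace.isOpen_of_mem_countableBasis (hVb x))
          (fun x hx => Set.mem_iUnion.2 ⟨⟨x, hx⟩, hxV _⟩)
        refine ⟨_, ⟨⟨V '' t, ⟨t.finite_toSet.image V, ?_⟩, rfl⟩, ?_⟩, ?_⟩
        · rintro _ ⟨x, -, rfl⟩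
          exact ⟨hVb x, hVc x⟩
        · intro D hD
          refine Set.subset_eq_empty (Set.inter_subset_inter_right _ (ht.trans ?_)) hD
          refine Set.iUnion₂_subset fun x hx => ?_
          exact subset_closure.trans (Set.subset_biUnion_of_mem (u := closure) ⟨x, hx, rfl⟩)
        · show C.carrier ∩ ⋃ W ∈ V '' t, closure W = ∅
          rw [Set.biUnion_image, Set.inter_iUnion₂, Set.iUnion_eq_empty]
          intro x
          rw [Set.iUnion_eq_empty]
          intro _
          rw [Set.inter_comm]; exact hVC x
      rw [this]
      exact TopologicalSpace.GenerateOpen.sUnion _ fun S hS =>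
        TopologicalSpace.GenerateOpen.basic _ (Or.inl hS.1)
    · have : {C : ClosedSubsets G | (C.carrier ∩ V).Nonempty} =
          ⋃₀ {S | S ∈ s₂ ∧ S ⊆ {C : ClosedSubsets G | (C.carrier ∩ V).Nonempty}} := by
        refine Set.Subset.antisymm ?_ (Set.sUnion_subset fun S hS => hS.2)
        rintro C ⟨x, hxC, hxV⟩
        obtain ⟨W, hW, hxW, hWV⟩ :=
          (TopologicalSpace.isBasis_countableBasis G).exists_subset_of_mem_open hxV hV
        exact ⟨_, ⟨⟨W, hW, rfl⟩, fun D hD => hD.mono (Set.inter_subset_inter_right _ hWV)⟩,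
          x, hxC, hxW⟩
      rw [this]
      exact TopologicalSpace.GenerateOpen.sUnion _ fun S hS =>
        TopologicalSpace.GenerateOpen.basic _ (Or.inr hS.1)

/-- Closedness of incidence makes the transversal compact and the domain of `(P, x) ↦ x⁻¹P`
measurable. -/
theorem isClosed_setOf_mem : IsClosed {p : ClosedSubsets G × G | p.2 ∈ p.1.carrier} := by
  rw [← isOpen_compl_iff, isOpen_iff_mem_nhds]
  rintro ⟨C, x⟩ hx
  obtain ⟨L, hL, hxL, hLC⟩ := exists_compact_subset C.isClosed.isOpen_compl hx
  have h1 : {D : ClosedSubsets G | D.carrier ∩ L = ∅} ∈ 𝓝 C :=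
    (isOpen_miss hL).mem_nhds
      (Set.disjoint_iff_inter_eq_empty.1 (Set.disjoint_right.2 fun y hy => hLC hy))
  filter_upwards [prod_mem_nhds h1 (isOpen_interior.mem_nhds hxL)] with p hp hmem
  exact (Set.eq_empty_iff_forall_notMem.1 hp.1 p.2) ⟨hmem, interior_subset hp.2⟩

/-- Disjoint neighbourhoods of the points of `F` must all be hit by closed sets near `C`. This
semicontinuity yields both measurability of counting and persistence of counting bounds on the hull.
-/
theorem eventually_card_le {V : Set G} (hV : IsOpen V) (C : ClosedSubsets G) (F : Finset G)
    (hF : (F : Set G) ⊆ C.carrier ∩ V) :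
    ∀ᶠ D in 𝓝 C, (F.card : ℕ∞) ≤ (D.carrier ∩ V).encard := by
  obtain ⟨W, hW, hdisj⟩ := F.finite_toSet.t2_separation
  have h1 : ∀ᶠ D in 𝓝 C, ∀ x ∈ F, (D.carrier ∩ (W x ∩ V)).Nonempty := by
    rw [Filter.eventually_all_finset]
    exact fun x hx => (isOpen_hit ((hW x).2.inter hV)).mem_nhds
      ⟨x, (hF hx).1, (hW x).1, (hF hx).2⟩
  filter_upwards [h1] with D hD
  choose! g hg using hD
  rw [← Set.encard_coe_eq_coe_finsetCard]
  refine Set.encard_le_encard_of_injOn (f := g) (fun x hx => ⟨(hg x hx).1, (hg x hx).2.2⟩) ?_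
  intro x hx y hy hxy
  by_contra hne
  exact Set.disjoint_left.1 (hdisj hx hy hne) (hg x hx).2.1 (hxy ▸ (hg y hy).2.1)

theorem exists_finset_of_lt_encard {α : Type*} {s : Set α} {n : ℕ} (h : (n : ℕ∞) < s.encard) :
    ∃ F : Finset α, (F : Set α) ⊆ s ∧ n < F.card := by
  obtain ⟨t, hts, ht⟩ := Set.exists_subset_encard_eq
    (k := ((n + 1 : ℕ) : ℕ∞)) (by exact_mod_cast Order.add_one_le_of_lt h)
  have hfin : t.Finite := Set.finite_of_encard_eq_coe ht
  refine ⟨hfin.toFinset, by simpa using hts, ?_⟩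
  rw [hfin.encard_eq_coe_toFinset_card] at ht
  have : hfin.toFinset.card = n + 1 := by exact_mod_cast ht
  omega

end Topology

/-! ### Joint continuity of translation -/

section Action

variable {G : Type*} [Group G] [TopologicalSpace G] [IsTopologicalGroup G] [T2Space G]
  [LocallyCompactSpace G]

instance : ContinuousSMul G (ClosedSubsets G) := by
  refine ⟨continuous_generateFrom_iff.2 ?_⟩
  rintro S (⟨K, hK, rfl⟩ | ⟨V, hV, rfl⟩)
  · rw [isOpen_iff_mem_nhds]
    rintro ⟨x, C⟩ hx
    have hx' : (x • C).carrier ∩ K = ∅ := hx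
    have hKC : x⁻¹ • K ⊆ C.carrierᶜ := by
      rintro _ ⟨k, hk, rfl⟩ hmem
      exact (Set.eq_empty_iff_forall_notMem.1 hx' k)
        ⟨Set.mem_smul_set_iff_inv_smul_mem.2 hmem, hk⟩
    obtain ⟨L, hL, hKL, hLC⟩ := exists_compact_between (hK.smul x⁻¹) C.isClosed.isOpen_compl hKC
    have h1 : ∀ᶠ y in 𝓝 x, ∀ k ∈ K, y⁻¹ • k ∈ interior L := by
      refine hK.eventually_forall_of_forall_eventually fun k hk => ?_
      have hcont : ContinuousAt (fun z : G × G => z.1⁻¹ • z.2) (x, k) := by fun_prop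
      exact hcont.eventually (isOpen_interior.mem_nhds (hKL ⟨k, hk, rfl⟩))
    have h2 : {D : ClosedSubsets G | D.carrier ∩ L = ∅} ∈ 𝓝 C :=
      (isOpen_miss hL).mem_nhds
        (Set.disjoint_iff_inter_eq_empty.1 (Set.disjoint_right.2 fun y hy => hLC hy))
    filter_upwards [prod_mem_nhds h1 h2] with p hp
    show (p.1 • p.2).carrier ∩ K = ∅
    refine Set.eq_empty_iff_forall_notMem.2 fun k hk => ?_
    exact (Set.eq_empty_iff_forall_notMem.1 hp.2 (p.1⁻¹ • k))
      ⟨Set.mem_smul_set_iff_inv_smul_mem.1 hk.1, interior_subset (hp.1 k hk.2)⟩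
  · rw [isOpen_iff_mem_nhds]
    rintro ⟨x, C⟩ hx
    obtain ⟨_, ⟨c, hc, rfl⟩, hxV⟩ : ((x • C).carrier ∩ V).Nonempty := hx
    have hcont : ContinuousAt (fun z : G × G => z.1 • z.2) (x, c) := by fun_prop
    obtain ⟨A, hA, W, hW, hAW⟩ := mem_nhds_prod_iff.1 (hcont.preimage_mem_nhds (hV.mem_nhds hxV))
    obtain ⟨W', hWW', hW'o, hcW'⟩ := mem_nhds_iff.1 hW
    have h2 : {D : ClosedSubsets G | (D.carrier ∩ W').Nonempty} ∈ 𝓝 C :=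
      (isOpen_hit hW'o).mem_nhds ⟨c, hc, hcW'⟩
    filter_upwards [prod_mem_nhds hA h2] with p hp
    obtain ⟨d, hd, hdW⟩ := hp.2
    exact ⟨p.1 • d, Set.smul_mem_smul_set hd, hAW (Set.mk_mem_prod hp.1 (hWW' hdW))⟩

end Action

end ClosedSubsets

/-! ### The counting kernel -/

section Kernel

open ProbabilityTheory

variable {G : Type*} [TopologicalSpace G] [T2Space G] [LocallyCompactSpace G]
  [SecondCountableTopology G] [MeasurableSpace G] [BorelSpace G]

/-- Counting points in an open set is lower semicontinuous. -/
theorem ClosedSubsets.measurable_count_inter {V : Set G} (hV : IsOpen V) :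
    Measurable fun C : ClosedSubsets G => Measure.count (C.carrier ∩ V) := by
  refine LowerSemicontinuous.measurable fun C y hy => ?_
  have hcount : ∀ D : ClosedSubsets G,
      Measure.count (D.carrier ∩ V) = ((D.carrier ∩ V).encard : ℝ≥0∞) := fun D =>
    Measure.count_apply (D.isClosed.measurableSet.inter hV.measurableSet)
  simp only [hcount] at hy ⊢
  obtain ⟨F, hF, hyF⟩ : ∃ F : Finset G, (F : Set G) ⊆ C.carrier ∩ V ∧ y < F.card := by
    rcases (C.carrier ∩ V).finite_or_infinite with hfin | hinf
    · refine ⟨hfin.toFinset, by simp, ?_⟩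
      rw [hfin.encard_eq_coe_toFinset_card] at hy
      simpa using hy
    · obtain ⟨n, hn⟩ := ENNReal.exists_nat_gt hy.ne_top
      obtain ⟨F, hF, hFn⟩ := hinf.exists_subset_card_eq n
      exact ⟨F, hF, by rwa [hFn]⟩
  filter_upwards [eventually_card_le hV C F hF] with D hD
  refine hyF.trans_le ?_
  exact_mod_cast ENat.toENNReal_mono hD

/-- A family of closed sets is uniformly locally finite. -/
def IsLocBounded {X : Type*} (c : X → ClosedSubsets G) : Prop :=
  ∀ K : Set G, IsCompact K → ∃ n : ℕ, ∀ x, ((c x).carrier ∩ K).encard ≤ n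

variable {X : Type*} [MeasurableSpace X] {c : X → ClosedSubsets G}

/-- Open sets form a generating π-system, but extending measurability from it requires finite
measures; hence the cutoff by `O`. -/
theorem measurable_count_restrict (hc : Measurable c) {O K : Set G} (hO : IsOpen O)
    (hK : ∃ n : ℕ, ∀ x, ((c x).carrier ∩ K).encard ≤ n) (hOK : O ⊆ K) :
    Measurable fun x => Measure.count.restrict ((c x).carrier ∩ O) := by
  obtain ⟨n, hn⟩ := hK
  have hm : ∀ x, MeasurableSet ((c x).carrier ∩ O) := fun x =>
    (c x).isClosed.measurableSet.inter hO.measurableSet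
  have : ∀ x, IsFiniteMeasure (Measure.count.restrict ((c x).carrier ∩ O)) := fun x => by
    refine ⟨?_⟩
    rw [Measure.restrict_apply_univ, Measure.count_apply_lt_top]
    refine Set.Finite.subset ?_ (Set.inter_subset_inter_right _ hOK)
    exact Set.finite_of_encard_le_coe (hn x)
  refine Measurable.measure_of_isPiSystem (S := {s | IsOpen s}) ?_ isPiSystem_isOpen ?_ ?_
  · exact BorelSpace.measurable_eq
  · intro V hV
    have : ∀ x, Measure.count.restrict ((c x).carrier ∩ O) V =
        Measure.count ((c x).carrier ∩ (O ∩ V)) := fun x => by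
      rw [Measure.restrict_apply (IsOpen.measurableSet hV), Set.inter_comm V, Set.inter_assoc]
    simp_rw [this]
    exact (ClosedSubsets.measurable_count_inter (hO.inter hV)).comp hc
  · simp_rw [Measure.restrict_apply_univ]
    exact (ClosedSubsets.measurable_count_inter hO).comp hc

/-- The counting kernel restricted to the interior of a member of the compact exhaustion. -/
def countKernelAux (hc : Measurable c) (hb : IsLocBounded c) (n : ℕ) : Kernel X G where
  toFun x := Measure.count.restrict ((c x).carrier ∩ interior (CompactExhaustion.choice G n))
  measurable' := measurable_count_restrict hc isOpen_interior
    (hb _ ((CompactExhaustion.choice G).isCompact n)) interior_subset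

instance (hc : Measurable c) (hb : IsLocBounded c) (n : ℕ) :
    IsFiniteKernel (countKernelAux hc hb n) := by
  obtain ⟨k, hk⟩ := hb _ ((CompactExhaustion.choice G).isCompact n)
  refine ⟨⟨k, by simp, fun x => ?_⟩⟩
  show Measure.count.restrict _ univ ≤ _
  rw [Measure.restrict_apply_univ, Measure.count_apply
    ((c x).isClosed.measurableSet.inter isOpen_interior.measurableSet)]
  refine le_trans (ENat.toENNReal_mono (Set.encard_le_encard
    (Set.inter_subset_inter_right _ interior_subset))) ?_
  exact_mod_cast ENat.toENNReal_mono (hk x)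

theorem iUnion_interior_exhaustion :
    ⋃ n, interior (CompactExhaustion.choice G n) = univ :=
  Set.eq_univ_of_forall fun x => by
    obtain ⟨n, hn⟩ := (CompactExhaustion.choice G).exists_mem x
    exact Set.mem_iUnion.2 ⟨n + 1, (CompactExhaustion.choice G).subset_interior_succ n hn⟩

/-- The kernel `x ↦ ∑_{p ∈ c x} δ_p`. -/
def countKernel (hc : Measurable c) (hb : IsLocBounded c) : Kernel X G :=
  -- Disjoint shells of the exhaustion prevent double counting, and a sum of finite kernels is
  -- s-finite.
  Kernel.sum fun n => (countKernelAux hc hb n).restrict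
    (MeasurableSet.disjointed (fun n => isOpen_interior.measurableSet
      (s := interior (CompactExhaustion.choice G n))) n)

instance (hc : Measurable c) (hb : IsLocBounded c) : IsSFiniteKernel (countKernel hc hb) := by
  unfold countKernel
  infer_instance

theorem countKernel_apply (hc : Measurable c) (hb : IsLocBounded c) (x : X) :
    countKernel hc hb x = Measure.count.restrict (c x).carrier := by
  set O : ℕ → Set G := fun n => interior (CompactExhaustion.choice G n) with hO
  have hm : ∀ n, MeasurableSet (O n) := fun n => isOpen_interior.measurableSet
  have hD : ∀ n, MeasurableSet (disjointed O n) := MeasurableSet.disjointed hm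
  rw [countKernel, Kernel.sum_apply]
  simp_rw [Kernel.restrict_apply]
  have h1 : ∀ n, (countKernelAux hc hb n x).restrict (disjointed O n) =
      (Measure.count.restrict (c x).carrier).restrict (disjointed O n) := fun n => by
    show (Measure.count.restrict ((c x).carrier ∩ O n)).restrict (disjointed O n) = _
    rw [Measure.restrict_restrict (hD n), Measure.restrict_restrict (hD n)]
    congr 1
    rw [Set.inter_comm _ (O n), ← Set.inter_assoc,
      Set.inter_eq_left.2 (disjointed_subset O n)]
  have h2 := Measure.restrict_iUnion (μ := Measure.count.restrict (c x).carrier)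
    (disjoint_disjointed O) hD
  rw [iUnion_disjointed, iUnion_interior_exhaustion, Measure.restrict_univ] at h2
  rw [h2]
  congr 1
  exact funext h1

theorem IsLocBounded.countable (hb : IsLocBounded c) (x : X) : (c x).carrier.Countable := by
  have : (c x).carrier = ⋃ n, (c x).carrier ∩ CompactExhaustion.choice G n := by
    rw [← Set.inter_iUnion, CompactExhaustion.iUnion_eq, Set.inter_univ]
  rw [this]
  refine Set.countable_iUnion fun n => Set.Finite.countable ?_
  obtain ⟨k, hk⟩ := hb _ ((CompactExhaustion.choice G).isCompact n)
  exact Set.finite_of_encard_le_coe (hk x)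

theorem integral_countKernel {E : Type*} [NormedAddCommGroup E] [NormedSpace ℝ E] [CompleteSpace E]
    (hc : Measurable c) (hb : IsLocBounded c) (x : X) {f : G → E}
    (hf : Integrable f (countKernel hc hb x)) :
    ∫ p, f p ∂countKernel hc hb x = ∑' p : (c x).carrier, f p := by
  rw [countKernel_apply] at hf ⊢
  rw [setIntegral_countable f (hb.countable x) hf]
  simp

end Kernel

/-! ### Transverse measures -/

section Transverse

open ProbabilityTheory

variable {G : Type*} [Group G] [TopologicalSpace G] [IsTopologicalGroup G] [T2Space G]
  [LocallyCompactSpace G] [SecondCountableTopology G] [MeasurableSpace G] [BorelSpace G]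
  {Λ : Set G}

instance : SecondCountableTopology (PuncturedHull Λ) :=
  TopologicalSpace.Subtype.secondCountableTopology
    {P : ClosedSubsets G | P ∈ hull Λ ∧ P.carrier.Nonempty}

instance : SecondCountableTopology (Transversal Λ) :=
  TopologicalSpace.Subtype.secondCountableTopology
    {P : ClosedSubsets G | P ∈ hull Λ ∧ (1 : G) ∈ P.carrier}

instance : CompactSpace (Transversal Λ) := by
  have h1 : IsClosed {P : ClosedSubsets G | (1 : G) ∈ P.carrier} :=
    ClosedSubsets.isClosed_setOf_mem.preimage (Continuous.prodMk_left (1 : G))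
  have h2 : IsClosed {P : ClosedSubsets G | P ∈ hull Λ ∧ (1 : G) ∈ P.carrier} :=
    isClosed_closure.inter h1
  exact isCompact_iff_compactSpace.1 h2.isCompact

/-- The underlying closed set of an element of the punctured hull. -/
def PuncturedHull.set (P : PuncturedHull Λ) : ClosedSubsets G := P.1

/-- The underlying closed set of an element of the transversal. -/
def Transversal.set (P : Transversal Λ) : ClosedSubsets G := P.1

theorem PuncturedHull.measurable_set :
    Measurable (PuncturedHull.set : PuncturedHull Λ → ClosedSubsets G) :=
  measurable_subtype_coe

theorem Transversal.measurable_set :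
    Measurable (Transversal.set : Transversal Λ → ClosedSubsets G) :=
  measurable_subtype_coe

/-- The elements of the hull are uniformly locally finite. -/
def HullLocBounded (Λ : Set G) : Prop :=
  ∀ K : Set G, IsCompact K → ∃ n : ℕ, ∀ P ∈ hull Λ, (P.carrier ∩ K).encard ≤ n

theorem HullLocBounded.puncturedHull (h : HullLocBounded Λ) :
    IsLocBounded (PuncturedHull.set : PuncturedHull Λ → ClosedSubsets G) := fun K hK =>
  (h K hK).imp fun _ hn P => hn P.1 P.2.1

theorem HullLocBounded.transversal (h : HullLocBounded Λ) :
    IsLocBounded (Transversal.set : Transversal Λ → ClosedSubsets G) := fun K hK =>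
  (h K hK).imp fun _ hn P => hn P.1 P.2.1

/-- More than `l` points of `P` in the open set `xU` would persist in a nearby translate of `Λ`. -/
theorem encard_inter_smul_le_of_mem_hull {U : Set G} (hU : IsOpen U) {l : ℕ}
    (h : ∀ x : G, (Λ ∩ x • U).encard ≤ l) {P : ClosedSubsets G} (hP : P ∈ hull Λ) (x : G) :
    (P.carrier ∩ x • U).encard ≤ l := by
  by_contra hlt
  obtain ⟨F, hF, hFl⟩ := ClosedSubsets.exists_finset_of_lt_encard (not_le.1 hlt)
  obtain ⟨D, hD, y, hy⟩ := mem_closure_iff_nhds.1 hP _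
    (ClosedSubsets.eventually_card_le (hU.smul x) P F hF)
  have h1 : (D.carrier ∩ x • U).encard ≤ l := by
    have : D.carrier ∩ x • U = y • (Λ ∩ (y⁻¹ * x) • U) := by
      rw [hy, Set.smul_set_inter, smul_smul, mul_inv_cancel_left]
    rw [this, ← Set.image_smul, (MulAction.injective y).encard_image]
    exact h _
  have h2 : (F.card : ℕ∞) ≤ l := le_trans hD h1
  have h3 : F.card ≤ l := by exact_mod_cast h2
  omega

/-- A compact set is covered by finitely many translates of `U`, each carrying at most `l` points.
-/
theorem IsRelSeparated.hullLocBounded (h : IsRelSeparated Λ) : HullLocBounded Λ := by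
  obtain ⟨U, hU, ⟨u, hu⟩, l, hl⟩ := h
  intro K hK
  refine hK.induction_on ⟨0, by simp⟩ ?_ ?_ ?_
  · rintro s t hst ⟨n, hn⟩
    exact ⟨n, fun P hP => (Set.encard_le_encard (Set.inter_subset_inter_right _ hst)).trans (hn P hP)⟩
  · rintro s t ⟨n, hn⟩ ⟨k, hk⟩
    refine ⟨n + k, fun P hP => ?_⟩
    rw [Set.inter_union_distrib_left]
    push_cast
    exact (Set.encard_union_le _ _).trans (add_le_add (hn P hP) (hk P hP))
  · intro x _
    refine ⟨(x * u⁻¹) • U, mem_nhdsWithin_of_mem_nhds ((hU.smul _).mem_nhds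
      ⟨u, hu, by simp⟩), l, fun P hP => encard_inter_smul_le_of_mem_hull hU hl hP _⟩

theorem PuncturedHull.measurable_const_smul (g : G) :
    Measurable fun P : PuncturedHull Λ => g • P :=
  Measurable.subtype_mk
    ((ClosedSubsets.continuous_const_smul g).measurable.comp measurable_subtype_coe)

open Classical in
/-- The map `(P, x) ↦ x⁻¹P` to the transversal, with a default value if `x ∉ P`. -/
def toTransversalOr (Z : Transversal Λ) (p : PuncturedHull Λ × G) : Transversal Λ :=
  if h : p.2 ∈ p.1.1.carrier then p.1.toTransversal ⟨p.2, h⟩ else Z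

theorem measurable_toTransversalOr (Z : Transversal Λ) : Measurable (toTransversalOr Z) := by
  classical
  have hset : MeasurableSet {p : PuncturedHull Λ × G | p.2 ∈ p.1.1.carrier} := by
    have h1 : Measurable fun p : PuncturedHull Λ × G => ((p.1.set, p.2) : ClosedSubsets G × G) :=
      (PuncturedHull.measurable_set.comp measurable_fst).prodMk measurable_snd
    exact h1 ClosedSubsets.isClosed_setOf_mem.measurableSet
  have h2 : Measurable fun p : PuncturedHull Λ × G => p.2⁻¹ • p.1.set :=
    (continuous_smul (M := G) (X := ClosedSubsets G)).measurable.comp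
      (measurable_snd.inv.prodMk (PuncturedHull.measurable_set.comp measurable_fst))
  have h3 : Measurable fun p : PuncturedHull Λ × G => (toTransversalOr Z p).set := by
    have : (fun p : PuncturedHull Λ × G => (toTransversalOr Z p).set) =
        fun p => if p.2 ∈ p.1.1.carrier then p.2⁻¹ • p.1.set else Z.set := by
      ext1 p
      unfold toTransversalOr
      split_ifs <;> rfl
    rw [this]
    exact Measurable.ite hset h2 measurable_const
  exact h3.subtype_mk

variable (hΛ : HullLocBounded Λ) (μ : Measure (PuncturedHull Λ)) (Z : Transversal Λ)

/-- The measure `A ↦ ∫ #{x ∈ P : (x, x⁻¹P) ∈ A} dμ(P)` on the product of `G` and the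
transversal. -/
def campbellMeasure : Measure (G × Transversal Λ) :=
  (μ ⊗ₘ countKernel PuncturedHull.measurable_set hΛ.puncturedHull).map
    fun p => (p.2, toTransversalOr Z p)

theorem measurable_prod_toTransversalOr :
    Measurable fun p : PuncturedHull Λ × G => (p.2, toTransversalOr Z p) :=
  measurable_snd.prodMk (measurable_toTransversalOr Z)

theorem campbellMeasure_prod [SFinite μ] {A : Set G} {B : Set (Transversal Λ)}
    (hA : MeasurableSet A) (hB : MeasurableSet B) :
    campbellMeasure hΛ μ Z (A ×ˢ B) =
      ∫⁻ P, Measure.count (P.1.carrier ∩ {x | x ∈ A ∧ toTransversalOr Z (P, x) ∈ B}) ∂μ := by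
  rw [campbellMeasure, Measure.map_apply (measurable_prod_toTransversalOr Z) (hA.prod hB),
    Measure.compProd_apply (measurable_prod_toTransversalOr Z (hA.prod hB))]
  refine lintegral_congr fun P => ?_
  rw [countKernel_apply, Measure.restrict_apply
    (measurable_prodMk_left (measurable_prod_toTransversalOr Z (hA.prod hB))), Set.inter_comm]
  rfl

theorem measurable_count_toTransversalOr (hΛ : HullLocBounded Λ) {A : Set G} {B : Set (Transversal Λ)}
    (hA : MeasurableSet A) (hB : MeasurableSet B) :
    Measurable fun P : PuncturedHull Λ =>
      Measure.count (P.1.carrier ∩ {x | x ∈ A ∧ toTransversalOr Z (P, x) ∈ B}) := by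
  have h := Kernel.measurable_kernel_prodMk_left
    (κ := countKernel PuncturedHull.measurable_set hΛ.puncturedHull)
    (measurable_prod_toTransversalOr Z (hA.prod hB))
  convert h using 2 with P
  rw [countKernel_apply, Measure.restrict_apply
    (measurable_prodMk_left (measurable_prod_toTransversalOr Z (hA.prod hB))), Set.inter_comm]
  rfl

theorem toTransversalOr_smul (g x : G) (P : PuncturedHull Λ) (hx : x ∈ P.1.carrier) :
    toTransversalOr Z (g • P, g * x) = toTransversalOr Z (P, x) := by
  have h1 : g * x ∈ (g • P).1.carrier := Set.smul_mem_smul_set (a := g) hx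
  rw [toTransversalOr, toTransversalOr, dif_pos h1, dif_pos hx]
  refine Subtype.ext (ClosedSubsets.ext ?_)
  show (g * x)⁻¹ • (g • P.1.carrier) = x⁻¹ • P.1.carrier
  rw [smul_smul, mul_inv_rev, inv_mul_cancel_right]

/-- The substitution `(P, x) ↦ (gP, gx)` translates the first coordinate and fixes `x⁻¹P`;
invariance of `μ` does the rest. -/
theorem campbellMeasure_prod_preimage [SFinite μ] [SMulInvariantMeasure G (PuncturedHull Λ) μ]
    {A : Set G} {B : Set (Transversal Λ)} (hA : MeasurableSet A) (hB : MeasurableSet B) (g : G) :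
    campbellMeasure hΛ μ Z (((g * ·) ⁻¹' A) ×ˢ B) = campbellMeasure hΛ μ Z (A ×ˢ B) := by
  have hmp : MeasurePreserving (fun P : PuncturedHull Λ => g • P) μ μ :=
    ⟨PuncturedHull.measurable_const_smul g, Measure.ext fun s hs => by
      rw [Measure.map_apply (PuncturedHull.measurable_const_smul g) hs]
      exact SMulInvariantMeasure.measure_preimage_smul g hs⟩
  rw [campbellMeasure_prod hΛ μ Z (measurable_const_mul g hA) hB,
    campbellMeasure_prod hΛ μ Z hA hB,
    ← hmp.lintegral_comp (measurable_count_toTransversalOr Z hΛ hA hB)]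
  refine lintegral_congr fun P => ?_
  rw [← Measure.count_injective_image (MulAction.injective g)]
  congr 1
  ext y
  constructor
  · rintro ⟨x, ⟨hx, hxA, hxB⟩, rfl⟩
    exact ⟨Set.smul_mem_smul_set hx, hxA, 
      (toTransversalOr_smul Z g x P hx).symm ▸ hxB⟩
  · rintro ⟨⟨x, hx, rfl⟩, hxA, hxB⟩
    exact ⟨x, ⟨hx, hxA, toTransversalOr_smul Z g x P hx ▸ hxB⟩, rfl⟩

theorem campbellMeasure_prod_lt_top [IsFiniteMeasure μ] {K : Set G} (hK : IsCompact K) :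
    campbellMeasure hΛ μ Z (K ×ˢ univ) < ∞ := by
  obtain ⟨n, hn⟩ := hΛ K hK
  rw [campbellMeasure_prod hΛ μ Z hK.measurableSet .univ]
  calc ∫⁻ P, Measure.count (P.1.carrier ∩ {x | x ∈ K ∧ toTransversalOr Z (P, x) ∈ univ}) ∂μ
      ≤ ∫⁻ _, n ∂μ := by
        refine lintegral_mono fun P => ?_
        simp only [mem_univ, and_true, Set.ofPred_mem_eq]
        rw [Measure.count_apply (P.1.isClosed.measurableSet.inter hK.measurableSet)]
        exact_mod_cast ENat.toENNReal_mono (hn P.1 P.2.1)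
    _ < ∞ := by
        rw [lintegral_const]
        exact ENNReal.mul_lt_top (by simp) (measure_lt_top _ _)

/-- For fixed `B` the measure `A ↦ ρ(A × B)` is left invariant and finite on compact sets, hence a
multiple of `m`. The factor, read off on a compact neighbourhood `K` of `1`, is `μ₀(B)`. -/
theorem exists_campbellMeasure_eq_prod (m : Measure G) [m.IsHaarMeasure] [IsFiniteMeasure μ]
    [SMulInvariantMeasure G (PuncturedHull Λ) μ] :
    ∃ μ₀ : Measure (Transversal Λ), IsFiniteMeasure μ₀ ∧ campbellMeasure hΛ μ Z = m.prod μ₀ := by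
  set ρ := campbellMeasure hΛ μ Z with hρ
  obtain ⟨K, hK, hK1⟩ := exists_compact_mem_nhds (1 : G)
  have hm0 : m K ≠ 0 := (Measure.measure_pos_of_mem_nhds m hK1).ne'
  have hmt : m K ≠ ∞ := hK.measure_lt_top.ne
  have hfin : ρ (K ×ˢ univ) < ∞ := campbellMeasure_prod_lt_top hΛ μ Z hK
  let μ₀ : Measure (Transversal Λ) := (m K)⁻¹ • (ρ.restrict (K ×ˢ univ)).map Prod.snd
  have hμ₀ : ∀ B, MeasurableSet B → μ₀ B = (m K)⁻¹ * ρ (K ×ˢ B) := by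
    intro B hB
    show (m K)⁻¹ * ((ρ.restrict (K ×ˢ univ)).map Prod.snd) B = _
    rw [Measure.map_apply measurable_snd hB, Measure.restrict_apply (measurable_snd hB)]
    congr 2
    ext p
    simp [and_comm]
  have hfin₀ : IsFiniteMeasure μ₀ := ⟨by
    rw [hμ₀ _ .univ]
    exact ENNReal.mul_lt_top (ENNReal.inv_lt_top.2 (pos_iff_ne_zero.2 hm0)) hfin⟩
  refine ⟨μ₀, hfin₀, (Measure.prod_eq fun A B hA hB => ?_).symm⟩
  let ν : Measure G := (ρ.restrict (univ ×ˢ B)).map Prod.fst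
  have hν : ∀ A, MeasurableSet A → ν A = ρ (A ×ˢ B) := by
    intro A hA
    rw [Measure.map_apply measurable_fst hA, Measure.restrict_apply (measurable_fst hA)]
    congr 1
    ext p
    simp
  have hleft : ν.IsMulLeftInvariant := ⟨fun g => Measure.ext fun A hA => by
    rw [Measure.map_apply (measurable_const_mul g) hA, hν _ hA, hν _ (measurable_const_mul g hA)]
    exact campbellMeasure_prod_preimage hΛ μ Z hA hB g⟩
  have hcomp : IsFiniteMeasureOnCompacts ν := ⟨fun L hL => by
    rw [hν L hL.measurableSet]
    exact (measure_mono (Set.prod_mono_right (Set.subset_univ B))).trans_lt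
      (campbellMeasure_prod_lt_top hΛ μ Z hL)⟩
  have hsm := Measure.isMulLeftInvariant_eq_smul ν m
  have h1 : ∀ A, MeasurableSet A → ρ (A ×ˢ B) = Measure.haarScalarFactor ν m * m A := by
    intro A hA
    rw [← hν A hA]
    conv_lhs => rw [hsm]
    rfl
  rw [hμ₀ B hB, h1 A hA, h1 K hK.measurableSet, mul_left_comm (m K)⁻¹, ENNReal.inv_mul_cancel hm0 hmt,
    mul_one, mul_comm]

/-- The formula is needed for all integrable `F`, since products of matrix coefficients need not
have compact support. -/
theorem integral_tsum_toTransversal {m : Measure G} [SFinite m] [SFinite μ]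
    {μ₀ : Measure (Transversal Λ)} [SFinite μ₀]
    (h : campbellMeasure hΛ μ Z = m.prod μ₀) {E : Type*} [NormedAddCommGroup E] [NormedSpace ℝ E]
    [CompleteSpace E] {F : G × Transversal Λ → E} (hF : Integrable F (m.prod μ₀)) :
    ∫ P : PuncturedHull Λ, ∑' x : P.1.carrier, F ((x : G), P.toTransversal x) ∂μ =
      ∫ Q, ∫ x, F (x, Q) ∂m ∂μ₀ := by
  rw [← integral_prod_symm F hF]
  rw [← h, campbellMeasure] at hF ⊢
  have hF' := hF.comp_measurable (measurable_prod_toTransversalOr Z)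
  rw [integral_map (measurable_prod_toTransversalOr Z).aemeasurable hF.aestronglyMeasurable,
    show ∫ p, F (p.2, toTransversalOr Z p) ∂_ = _ from Measure.integral_compProd hF']
  refine integral_congr_ae ?_
  filter_upwards [((Measure.integrable_compProd_iff hF'.aestronglyMeasurable).1 hF').1] with P hP
  refine Eq.trans ?_ (integral_countKernel _ _ _ hP).symm
  refine tsum_congr fun x => ?_
  have : toTransversalOr Z (P, (x : G)) = P.toTransversal x := dif_pos x.2
  exact congrArg (fun Q => F ((x : G), Q)) this.symm

theorem isTransverseMeasure_of_campbellMeasure_eq {m : Measure G} [m.IsHaarMeasure] [SFinite μ]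
    {μ₀ : Measure (Transversal Λ)} [hfin : IsFiniteMeasure μ₀]
    (h : campbellMeasure hΛ μ Z = m.prod μ₀) : IsTransverseMeasure m μ μ₀ := by
  refine ⟨hfin, fun F hF hFc => integral_tsum_toTransversal hΛ μ Z h ?_⟩
  exact hF.integrable_of_hasCompactSupport hFc

/-- The total mass of a transverse measure only depends on the given measure. -/
theorem IsTransverseMeasure.measure_univ_eq {m : Measure G} [m.IsHaarMeasure]
    {μ : Measure (PuncturedHull Λ)} {μ₀ μ₁ : Measure (Transversal Λ)}
    (h₀ : IsTransverseMeasure m μ μ₀) (h₁ : IsTransverseMeasure m μ μ₁) :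
    μ₀ univ = μ₁ univ := by
  have := h₀.1
  have := h₁.1
  obtain ⟨f, hf, hsupp, hpos⟩ : ∃ f : G → ℝ, Continuous f ∧ HasCompactSupport f ∧ 0 < ∫ x, f x ∂m := by
    obtain ⟨φ, hφ, hφ0, hφ1⟩ := exists_continuous_nonneg_pos (1 : G)
    exact ⟨φ, φ.continuous, hφ, φ.continuous.integral_pos_of_hasCompactSupport_nonneg_nonzero
      hφ hφ0 hφ1⟩
  -- The transversal is compact, so a function of the group variable alone is an allowed test
  -- function; it detects the total mass.
  have hcs : HasCompactSupport fun p : G × Transversal Λ => f p.1 := by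
    refine HasCompactSupport.intro' (K := tsupport f ×ˢ univ) (hsupp.isCompact.prod isCompact_univ)
      ((isClosed_tsupport f).prod isClosed_univ) fun p hp => ?_
    refine image_eq_zero_of_notMem_tsupport fun h => hp ⟨h, mem_univ _⟩
  have e₀ := h₀.2 (fun p => f p.1) (hf.comp continuous_fst) hcs
  have e₁ := h₁.2 (fun p => f p.1) (hf.comp continuous_fst) hcs
  rw [e₀] at e₁
  simp only [integral_const, smul_eq_mul] at e₁
  have h2 := mul_right_cancel₀ hpos.ne' e₁
  exact (measureReal_eq_measureReal_iff).1 h2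

theorem isTransverseMeasure_transverseMeasure {m : Measure G} {μ : Measure (PuncturedHull Λ)}
    (h : ∃ μ₀, IsTransverseMeasure m μ μ₀) : IsTransverseMeasure m μ (transverseMeasure m μ) := by
  rw [transverseMeasure, dif_pos h]
  exact h.choose_spec

end Transverse

/-! ### Coherent systems over the hull -/

section Hull

variable {G : Type*} [Group G] [TopologicalSpace G] [IsTopologicalGroup G] [T2Space G]
  {Λ : Set G}

theorem encard_smul_inter_smul_le {U : Set G} {l : ℕ} (h : ∀ x : G, (Λ ∩ x • U).encard ≤ l)
    (y x : G) : (y • Λ ∩ x • U).encard ≤ l := by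
  have : y • Λ ∩ x • U = y • (Λ ∩ (y⁻¹ * x) • U) := by
    rw [Set.smul_set_inter, smul_smul, mul_inv_cancel_left]
  rw [this, ← Set.image_smul, (MulAction.injective y).encard_image]
  exact h _

/-- Finitely many distinct points of an element of the hull are limits of distinct points of
translates of `Λ`. -/
theorem mem_closure_of_mem_hull {P : ClosedSubsets G} (hP : P ∈ hull Λ) {ι : Type*} [Finite ι]
    {p : ι → G} (hp : Function.Injective p) (hmem : ∀ i, p i ∈ P.carrier) :
    p ∈ closure {q : ι → G | Function.Injective q ∧ ∃ x : G, ∀ i, q i ∈ x • Λ} := by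
  rw [mem_closure_iff]
  intro O hO hpO
  have hinj : IsOpen {q : ι → G | Function.Injective q} := by
    have : {q : ι → G | Function.Injective q} =
        ⋂ i, ⋂ j, ⋂ (_ : i ≠ j), {q : ι → G | q i ≠ q j} := by
      ext q
      simp only [mem_ofPred_eq, mem_iInter]
      exact ⟨fun h i j hij => h.ne hij, fun h i j hij => by_contra fun hne => h i j hne hij⟩
    rw [this]
    exact isOpen_iInter_of_finite fun i => isOpen_iInter_of_finite fun j =>
      isOpen_iInter_of_finite fun _ => isOpen_ne_fun (continuous_apply i) (continuous_apply j)
  obtain ⟨u, hu, huO⟩ := isOpen_pi_iff'.1 (hO.inter hinj) p ⟨hpO, hp⟩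
  have hev : ∀ᶠ C in 𝓝 P, ∀ i, (C.carrier ∩ u i).Nonempty :=
    Filter.eventually_all.2 fun i =>
      (ClosedSubsets.isOpen_hit (hu i).1).mem_nhds ⟨p i, hmem i, (hu i).2⟩
  obtain ⟨C, hC, x, hx⟩ := mem_closure_iff_nhds.1 hP _ hev
  choose q hq using hC
  have hqO := huO (show q ∈ univ.pi u from fun i _ => (hq i).2)
  exact ⟨q, hqO.1, hqO.2, x, fun i => hx ▸ (hq i).1⟩

end Hull

/-! ### Bessel and Riesz bounds of coherent systems over the hull -/

section Systems

variable {G : Type*} [Group G] [TopologicalSpace G] {σ : Cocycle G}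
  {H : Type*} [NormedAddCommGroup H] [InnerProductSpace ℂ H]

namespace ProjRep

/-- The coherent system `(π(p) η)_{p ∈ S}`. -/
def system (π : ProjRep σ H) (η : H) (S : Set G) (p : S) : H := π.toFun p η

theorem norm_coeff_mul (π : ProjRep σ H) (η ξ : H) (x y : G) :
    ‖π.coeff η ξ (x * y)‖ = ‖π.coeff η ((π.toFun x).symm ξ) y‖ := by
  conv_lhs => rw [← (π.toFun x).apply_symm_apply ξ]
  rw [coeff_smul_left, norm_mul, Circle.norm_coe, one_mul]

variable (π : ProjRep σ H) {η : H} {S : Set G} {A B : ℝ}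

theorem _root_.CoherentSystems.IsBessel.sum_le {J ι : Type*} [Fintype ι] {e : J → H}
    (h : IsBessel e B) (hB : 0 ≤ B) {f : ι → J} (hf : Function.Injective f) (ξ : H) :
    ∑ i, ‖inner ℂ (e (f i)) ξ‖ ^ 2 ≤ B * ‖ξ‖ ^ 2 := by
  have := (isBessel_iff hB).1 h (Finset.univ.map ⟨f, hf⟩) ξ
  rwa [Finset.sum_map] at this

/-- A Bessel system is relatively separated. -/
theorem exists_encard_le_of_isBessel [IsTopologicalGroup G] (hη : η ≠ 0) (hB : 0 ≤ B)
    (h : IsBessel (π.system η S) B) :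
    ∃ U : Set G, IsOpen U ∧ 1 ∈ U ∧ ∃ l : ℕ, ∀ x : G, (S ∩ x • U).encard ≤ l := by
  have hn : 0 < ‖η‖ := norm_pos_iff.2 hη
  -- Each point of `S ∩ xU` contributes at least `‖η‖⁴ / 4` to the Bessel sum at `π(x)η`, which is
  -- at most `B ‖η‖²`; so there are at most `4B / ‖η‖²` of them.
  refine ⟨{y | ‖η‖ ^ 2 / 2 < ‖π.coeff η η y‖},
    isOpen_lt continuous_const (π.continuous_coeff η η).norm, ?_, ⌊4 * B / ‖η‖ ^ 2⌋₊, fun x => ?_⟩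
  · show ‖η‖ ^ 2 / 2 < ‖inner ℂ (π.toFun 1 η) η‖
    rw [toFun_one, inner_self_eq_norm_sq_to_K]
    simp
    positivity
  · by_contra hlt
    obtain ⟨F, hF, hFl⟩ := ClosedSubsets.exists_finset_of_lt_encard (not_le.1 hlt)
    have h1 := h.sum_le hB (f := fun i : F => (⟨i, (hF i.2).1⟩ : S))
      (fun i j hij => Subtype.ext (congrArg (fun s : S => (s : G)) hij)) (π.toFun x η)
    rw [LinearIsometryEquiv.norm_map] at h1
    have h2 : ∀ i : F, (‖η‖ ^ 2 / 2) ^ 2 ≤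
        ‖inner ℂ (π.system η S ⟨i, (hF i.2).1⟩) (π.toFun x η)‖ ^ 2 := by
      intro i
      obtain ⟨y, hy, hyi⟩ := (hF i.2).2
      have h3 : ‖inner ℂ (π.system η S ⟨i, (hF i.2).1⟩) (π.toFun x η)‖ = ‖π.coeff η η y‖ := by
        show ‖π.coeff η (π.toFun x η) i‖ = _
        rw [← hyi]
        show ‖π.coeff η (π.toFun x η) (x * y)‖ = _
        rw [norm_coeff_mul, LinearIsometryEquiv.symm_apply_apply]
      rw [h3]
      exact pow_le_pow_left₀ (by positivity) hy.le 2
    have h4 := (Finset.sum_le_sum fun i (_ : i ∈ Finset.univ) => h2 i).trans h1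
    rw [Finset.sum_const, nsmul_eq_mul, Finset.card_univ, Fintype.card_coe] at h4
    have h5 : (F.card : ℝ) ≤ 4 * B / ‖η‖ ^ 2 := by
      rw [le_div_iff₀ (by positivity)]
      have h6 : (F.card : ℝ) * ‖η‖ ^ 2 * ‖η‖ ^ 2 ≤ 4 * B * ‖η‖ ^ 2 := by nlinarith
      exact le_of_mul_le_mul_right h6 (by positivity)
    exact absurd (Nat.le_floor h5) (not_le.2 hFl)

variable [IsTopologicalGroup G] [T2Space G] {Λ : Set G}

/-- The inequality for finitely many points is closed in the points and holds for all translates of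
`Λ`, because `π(x)` is unitary. -/
theorem isBessel_of_mem_hull (hB : 0 ≤ B) (h : IsBessel (π.system η Λ) B) {P : ClosedSubsets G}
    (hP : P ∈ hull Λ) : IsBessel (π.system η P.carrier) B := by
  rw [isBessel_iff hB]
  intro F ξ
  have hcl := mem_closure_of_mem_hull hP (p := fun i : F => ((i : P.carrier) : G))
    (fun i j hij => Subtype.ext (Subtype.ext hij)) (fun i => i.1.2)
  have hclosed : IsClosed {q : F → G | ∑ i, ‖π.coeff η ξ (q i)‖ ^ 2 ≤ B * ‖ξ‖ ^ 2} :=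
    isClosed_le (continuous_finsetSum _ fun i _ =>
      ((π.continuous_coeff η ξ).comp (continuous_apply i)).norm.pow 2) continuous_const
  have hmem := closure_minimal (s := {q : F → G | Function.Injective q ∧ ∃ x : G, ∀ i, q i ∈ x • Λ})
    ?_ hclosed hcl
  · rw [← Finset.sum_coe_sort]
    exact hmem
  · rintro q ⟨hq, x, hx⟩
    choose f hf hfq using hx
    have hfinj : Function.Injective fun i => (⟨f i, hf i⟩ : Λ) := fun i j hij =>
      hq (by rw [← hfq i, ← hfq j]; exact congrArg (fun s : Λ => x • (s : G)) hij)
    have h1 := h.sum_le hB hfinj ((π.toFun x).symm ξ)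
    rw [LinearIsometryEquiv.norm_map] at h1
    refine le_trans (Finset.sum_le_sum fun i _ => ?_) h1
    rw [← hfq i]
    exact (congrArg (· ^ 2) (π.norm_coeff_mul η ξ x (f i))).le

theorem le_norm_sum_of_mem_hull
    (h : ∀ (F : Finset Λ) (c : Λ → ℂ), A * ∑ j ∈ F, ‖c j‖ ^ 2 ≤ ‖∑ j ∈ F, c j • π.system η Λ j‖ ^ 2)
    {P : ClosedSubsets G} (hP : P ∈ hull Λ) (F : Finset P.carrier) (c : P.carrier → ℂ) :
    A * ∑ j ∈ F, ‖c j‖ ^ 2 ≤ ‖∑ j ∈ F, c j • π.system η P.carrier j‖ ^ 2 := by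
  have hcl := mem_closure_of_mem_hull hP (p := fun i : F => ((i : P.carrier) : G))
    (fun i j hij => Subtype.ext (Subtype.ext hij)) (fun i => i.1.2)
  have hclosed : IsClosed {q : F → G |
      A * ∑ j : F, ‖c j‖ ^ 2 ≤ ‖∑ j : F, c j • π.toFun (q j) η‖ ^ 2} :=
    isClosed_le continuous_const ((continuous_finsetSum _ fun i _ =>
      ((π.strongly_continuous η).comp (continuous_apply i)).const_smul _).norm.pow 2)
  have hmem := closure_minimal (s := {q : F → G | Function.Injective q ∧ ∃ x : G, ∀ i, q i ∈ x • Λ})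
    ?_ hclosed hcl
  · rw [← Finset.sum_coe_sort F, ← Finset.sum_coe_sort F]
    exact hmem
  · rintro q ⟨hq, x, hx⟩
    choose f hf hfq using hx
    have hfinj : Function.Injective fun i => (⟨f i, hf i⟩ : Λ) := fun i j hij =>
      hq (by rw [← hfq i, ← hfq j]; exact congrArg (fun s : Λ => x • (s : G)) hij)
    -- The cocycle phases from translating by `x` are absorbed into the coefficients without
    -- changing their moduli.
    have h1 := h (Finset.univ.map ⟨_, hfinj⟩) (Function.extend (fun i => (⟨f i, hf i⟩ : Λ))
      (fun i => c i * conj (σ.toFun x (f i) : ℂ)) 0)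
    simp only [Finset.sum_map, Function.Embedding.coeFn_mk, hfinj.extend_apply] at h1
    show A * ∑ j : F, ‖c j‖ ^ 2 ≤ ‖∑ j : F, c j • π.toFun (q j) η‖ ^ 2
    have h2 : ∑ j : F, c j • π.toFun (q j) η = π.toFun x (∑ j : F,
        (c j * conj (σ.toFun x (f j) : ℂ)) • π.system η Λ ⟨f j, hf j⟩) := by
      rw [map_sum]
      refine Finset.sum_congr rfl fun j _ => ?_
      rw [map_smul, mul_smul, system, ← toFun_mul, ← hfq j]
      rfl
    rw [h2, LinearIsometryEquiv.norm_map]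
    simpa only [norm_mul, RCLike.norm_conj, Circle.norm_coe, mul_one] using h1

end ProjRep

end Systems

/-! ### The lower frame bound over the hull -/

section Frame

variable {G : Type*} [Group G] [TopologicalSpace G] [IsTopologicalGroup G]

theorem tsum_le_encard_mul {S : Set G} {f : G → ℝ≥0∞} {a : ℝ≥0∞} {l : ℕ} (hS : S.encard ≤ l)
    (hf : ∀ s ∈ S, f s ≤ a) : ∑' s : S, f s ≤ l * a := by
  calc ∑' s : S, f s ≤ ∑' _ : S, a := ENNReal.tsum_le_tsum fun s => hf s s.2
    _ = (S.encard : ℝ≥0∞) * a := by rw [ENNReal.tsum_const]; rfl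
    _ ≤ l * a := by
      gcongr
      exact_mod_cast ENat.toENNReal_mono hS

variable [T2Space G] [LocallyCompactSpace G] [SecondCountableTopology G] {Λ : Set G}

/-- Sums over translates of `Λ` in a compact set are controlled by the sum over an element of the
hull; the factor `l` accounts for points that merge in the limit. -/
theorem exists_tsum_inter_le {U : Set G} (hU : IsOpen U) (hU1 : 1 ∈ U) {l : ℕ}
    (hl : ∀ x : G, (Λ ∩ x • U).encard ≤ l) {f : G → ℝ≥0∞} (hf : Continuous f)
    (hfin : ∀ x, f x ≠ ∞) {P : ClosedSubsets G} (hP : P ∈ hull Λ) {K : Set G} (hK : IsCompact K)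
    {ε : ℝ≥0∞} (hε : ε ≠ 0) :
    ∃ x : G, ∑' s : ↥(x • Λ ∩ K), f s ≤ l * (∑' p : P.carrier, f p) + ε := by
  borelize G
  obtain ⟨n, hn⟩ := (IsRelSeparated.hullLocBounded ⟨U, hU, ⟨1, hU1⟩, l, hl⟩) K hK
  have hPK : (P.carrier ∩ K).Finite := Set.finite_of_encard_le_coe (hn P hP)
  set F := hPK.toFinset with hF
  obtain ⟨δ, hδ, hδε⟩ : ∃ δ : ℝ≥0∞, δ ≠ 0 ∧ (F.card * l : ℝ≥0∞) * δ ≤ ε := by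
    rcases eq_or_ne (F.card * l : ℝ≥0∞) 0 with h | h
    · exact ⟨1, one_ne_zero, by simp [h]⟩
    · refine ⟨ε / (F.card * l), ENNReal.div_ne_zero.2 ⟨hε, ?_⟩, ENNReal.mul_div_le⟩
      exact ENNReal.mul_ne_top (by simp) (by simp)
  -- Around each point `p` of `P ∩ K`, the neighbourhood holds at most `l` points of any translate
  -- of `Λ`, and `f < f p + δ` there. The rest of `K` is compact and missed by `P`, hence by a
  -- nearby translate.
  set V : G → Set G := fun p => p • U ∩ {t | f t < f p + δ} with hV
  have hVo : ∀ p, IsOpen (V p) := fun p =>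
    (hU.smul p).inter (isOpen_lt hf continuous_const)
  have hpV : ∀ p, p ∈ V p := fun p =>
    ⟨⟨1, hU1, by simp⟩, ENNReal.lt_add_right (hfin p) hδ⟩
  have hK' : IsCompact (K \ ⋃ p ∈ F, V p) := hK.diff (isOpen_biUnion fun p _ => hVo p)
  have hPK' : P.carrier ∩ (K \ ⋃ p ∈ F, V p) = ∅ := by
    refine Set.eq_empty_iff_forall_notMem.2 fun p hp => hp.2.2 ?_
    exact Set.mem_biUnion (hPK.mem_toFinset.2 ⟨hp.1, hp.2.1⟩) (hpV p)
  obtain ⟨C, hC, x, hx⟩ := mem_closure_iff_nhds.1 hP _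
    ((ClosedSubsets.isOpen_miss hK').mem_nhds hPK')
  have hsub : x • Λ ∩ K ⊆ ⋃ p ∈ F, x • Λ ∩ V p := by
    rintro s ⟨hs, hsK⟩
    by_contra hns
    refine (Set.eq_empty_iff_forall_notMem.1 hC s) ⟨hx ▸ hs, hsK, fun h => hns ?_⟩
    obtain ⟨p, hp, hsp⟩ := Set.mem_iUnion₂.1 h
    exact Set.mem_biUnion hp ⟨hs, hsp⟩
  refine ⟨x, ?_⟩
  calc ∑' s : ↥(x • Λ ∩ K), f s ≤ ∑' s : ↥(⋃ p ∈ F, x • Λ ∩ V p), f s :=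
        ENNReal.tsum_mono_subtype _ hsub
    _ ≤ ∑ p ∈ F, ∑' s : ↥(x • Λ ∩ V p), f s := ENNReal.tsum_biUnion_le _ _ _
    _ ≤ ∑ p ∈ F, l * (f p + δ) := by
        refine Finset.sum_le_sum fun p _ => tsum_le_encard_mul ?_ fun s hs => hs.2.2.le
        exact (Set.encard_le_encard (Set.inter_subset_inter_right _ Set.inter_subset_left)).trans
          (encard_smul_inter_smul_le hl x p)
    _ = l * ∑ p ∈ F, f p + F.card * l * δ := by
        rw [← Finset.mul_sum, Finset.sum_add_distrib, Finset.sum_const, nsmul_eq_mul]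
        ring
    _ ≤ l * (∑' p : P.carrier, f p) + ε := by
        gcongr
        have : ∑ p ∈ F, f p = ∑' p : F, f p := (Finset.tsum_subtype F f).symm
        rw [this]
        exact ENNReal.tsum_mono_subtype f (s := (F : Set G)) fun p hp =>
          (hPK.mem_toFinset.1 hp).1

variable [MeasurableSpace G] [BorelSpace G] {m : Measure G} [m.IsHaarMeasure]

/-- The tails of a function with square integrable local maximum are uniformly small on the
translates of a relatively separated set. -/
theorem exists_isCompact_tsum_diff_le {U : Set G} (hU : IsOpen U) (hU1 : 1 ∈ U) {l : ℕ}
    (hl : ∀ x : G, (Λ ∩ x • U).encard ≤ l) (hΛ : Λ.Countable) {Q : Set G} (hQ : IsCompact Q)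
    (hQ1 : Q ∈ 𝓝 (1 : G)) {f : G → ℂ} (hf : MemLp (localMax Q f) 2 m) {ε : ℝ≥0∞} (hε : ε ≠ 0) :
    ∃ K : Set G, IsCompact K ∧ ∀ x : G, ∑' s : ↥(x • Λ \ K), ‖f s‖ₑ ^ 2 ≤ ε := by
  set g : G → ℝ≥0∞ := fun t => localMax Q f t ^ 2 with hg
  have hgm : AEMeasurable g m := hf.1.aemeasurable.pow_const 2
  have hgfin : ∫⁻ t, g t ∂m ≠ ∞ := by
    have := (eLpNorm_lt_top_iff_lintegral_rpow_enorm_lt_top (by norm_num) (by norm_num)).1 hf.2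
    refine ne_of_lt ?_
    simpa [hg] using this
  -- If `t ∈ sV⁻¹`, then `s ∈ tQ`, so `|f(s)|²` is at most `g t`. A given `t` lies in at most `l` of
  -- the sets `sV⁻¹`, because `V ⊆ U`; and `s ∉ LQ` forces `t ∉ L`. Summing the integrals over
  -- `sV⁻¹` bounds the tail by the integral of `g` off `L`, for all translates at once.
  set V := interior Q ∩ U with hV
  have hVo : IsOpen V := isOpen_interior.inter hU
  have hV1 : (1 : G) ∈ V := ⟨mem_interior_iff_mem_nhds.2 hQ1, hU1⟩
  have hWo : IsOpen V⁻¹ := hVo.inv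
  have hm0 : m V⁻¹ ≠ 0 := (hWo.measure_pos m ⟨1, by simpa using hV1⟩).ne'
  have hmt : m V⁻¹ ≠ ∞ :=
    (measure_mono (Set.inv_subset_inv.2 (Set.inter_subset_left.trans interior_subset))).trans_lt
      hQ.inv.measure_lt_top |>.ne
  have hmem : ∀ s t : G, t ∈ s • V⁻¹ ↔ s ∈ t • V := fun s t => by
    rw [Set.mem_smul_set_iff_inv_smul_mem, Set.mem_smul_set_iff_inv_smul_mem, Set.mem_inv]
    simp
  have key : ∀ (L : Set G) (_ : IsCompact L) (x : G),
      m V⁻¹ * ∑' s : ↥(x • Λ \ (L * Q)), ‖f s‖ₑ ^ 2 ≤ l * ∫⁻ t in Lᶜ, g t ∂m := by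
    intro L hL x
    have hcount : (x • Λ \ (L * Q)).Countable := (hΛ.image _).mono Set.sdiff_subset
    have : Countable ↥(x • Λ \ (L * Q)) := hcount.to_subtype
    calc m V⁻¹ * ∑' s : ↥(x • Λ \ (L * Q)), ‖f s‖ₑ ^ 2
        = ∑' s : ↥(x • Λ \ (L * Q)), m V⁻¹ * ‖f s‖ₑ ^ 2 := ENNReal.tsum_mul_left.symm
      _ ≤ ∑' s : ↥(x • Λ \ (L * Q)), ∫⁻ t, ((s : G) • V⁻¹).indicator g t ∂m := by
          refine ENNReal.tsum_le_tsum fun s => ?_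
          rw [lintegral_indicator (hWo.smul (s : G)).measurableSet, ← measure_smul m (s : G) V⁻¹,
            mul_comm, ← setLIntegral_const]
          refine setLIntegral_mono' (hWo.smul (s : G)).measurableSet fun t ht => ?_
          have hst : (s : G) ∈ t • Q := Set.smul_set_mono
            (Set.inter_subset_left.trans interior_subset) ((hmem s t).1 ht)
          have hle : ‖f s‖ₑ ≤ localMax Q f t :=
            le_iSup₂_of_le (f := fun (u : G) (_ : u ∈ t • Q) => ‖f u‖ₑ) (s : G) hst le_rfl
          exact pow_le_pow_left' hle 2
      _ = ∫⁻ t, ∑' s : ↥(x • Λ \ (L * Q)), ((s : G) • V⁻¹).indicator g t ∂m :=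
          (lintegral_tsum (f := fun (s : ↥(x • Λ \ (L * Q))) => ((s : G) • V⁻¹).indicator g)
            fun s => hgm.indicator (hWo.smul (s : G)).measurableSet).symm
      _ ≤ ∫⁻ t, Lᶜ.indicator (fun t => l * g t) t ∂m := by
          refine lintegral_mono fun t => ?_
          by_cases ht : t ∈ L
          · rw [Set.indicator_of_notMem (by simpa using ht)]
            refine (ENNReal.tsum_eq_zero.2 fun s => Set.indicator_of_notMem (fun hs => ?_) _).le
            refine s.2.2 ?_
            obtain ⟨v, hv, hvs⟩ := (hmem s t).1 hs
            exact ⟨t, ht, v, interior_subset hv.1, hvs⟩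
          · rw [Set.indicator_of_mem (by simpa using ht)]
            have h1 : ∀ s : ↥(x • Λ \ (L * Q)), ((s : G) • V⁻¹).indicator g t =
                (t • V).indicator (fun _ => g t) (s : G) := fun s => by
              by_cases hs : t ∈ (s : G) • V⁻¹
              · rw [Set.indicator_of_mem hs, Set.indicator_of_mem ((hmem s t).1 hs)]
              · rw [Set.indicator_of_notMem hs,
                  Set.indicator_of_notMem (fun h => hs ((hmem s t).2 h))]
            simp_rw [h1]
            rw [tsum_subtype (x • Λ \ (L * Q)) ((t • V).indicator fun _ => g t),
              Set.indicator_indicator, ← tsum_subtype ((x • Λ \ (L * Q)) ∩ t • V)]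
            refine tsum_le_encard_mul (f := fun _ => g t) ?_ fun s _ => le_rfl
            refine le_trans (Set.encard_le_encard ?_) (encard_smul_inter_smul_le hl x t)
            exact Set.inter_subset_inter Set.sdiff_subset (Set.smul_set_mono Set.inter_subset_right)
      _ = l * ∫⁻ t in Lᶜ, g t ∂m := by
          rw [lintegral_indicator hL.measurableSet.compl,
            lintegral_const_mul' _ _ (ENNReal.natCast_ne_top l)]
  have hlim : Filter.Tendsto (fun n => l * ∫⁻ t in (CompactExhaustion.choice G n)ᶜ, g t ∂m)
      Filter.atTop (𝓝 0) := by
    have hν : IsFiniteMeasure (m.withDensity g) := isFiniteMeasure_withDensity hgfin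
    have h1 := tendsto_measure_iInter_atTop (μ := m.withDensity g)
      (s := fun n => (CompactExhaustion.choice G n)ᶜ)
      (fun n => ((CompactExhaustion.choice G).isCompact n).measurableSet.compl.nullMeasurableSet)
      (fun i j hij => Set.compl_subset_compl.2 ((CompactExhaustion.choice G).subset hij))
      ⟨0, measure_ne_top _ _⟩
    rw [← Set.compl_iUnion, CompactExhaustion.iUnion_eq, Set.compl_univ, measure_empty] at h1
    have h2 := ENNReal.Tendsto.const_mul (a := (l : ℝ≥0∞)) h1 (Or.inr (ENNReal.natCast_ne_top l))
    rw [mul_zero] at h2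
    refine h2.congr fun n => ?_
    rw [Function.comp_apply, withDensity_apply _ ((CompactExhaustion.choice G).isCompact n).measurableSet.compl]
  obtain ⟨n, hn⟩ := (hlim.eventually (gt_mem_nhds
    (pos_iff_ne_zero.2 (mul_ne_zero hm0 hε) : 0 < m V⁻¹ * ε))).exists
  refine ⟨CompactExhaustion.choice G n * Q, ((CompactExhaustion.choice G).isCompact n).mul hQ,
    fun x => ?_⟩
  exact (ENNReal.mul_le_mul_iff_right hm0 hmt).1
    ((key _ ((CompactExhaustion.choice G).isCompact n) x).trans hn.le)

variable {σ : Cocycle G} {H : Type*} [NormedAddCommGroup H] [InnerProductSpace ℂ H]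

/-- The lower frame bound passes to the hull up to a constant. -/
theorem ProjRep.lower_bound_of_mem_hull (π : ProjRep σ H) {η : H} {U : Set G} (hU : IsOpen U)
    (hU1 : 1 ∈ U) {l : ℕ} (hl : ∀ x : G, (Λ ∩ x • U).encard ≤ l) (hΛ : Λ.Countable) {Q : Set G}
    (hQ : IsCompact Q) (hQ1 : Q ∈ 𝓝 (1 : G)) (hη : π.IsAdmissible m Q η) {A : ℝ}
    (hA : ∀ ξ, ENNReal.ofReal (A * ‖ξ‖ ^ 2) ≤ ∑' j, ‖inner ℂ (π.system η Λ j) ξ‖ₑ ^ 2)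
    {P : ClosedSubsets G} (hP : P ∈ hull Λ) (ξ : H) :
    ENNReal.ofReal (A * ‖ξ‖ ^ 2) ≤ l * ∑' p, ‖inner ℂ (π.system η P.carrier p) ξ‖ₑ ^ 2 := by
  set f : G → ℝ≥0∞ := fun t => ‖π.coeff η ξ t‖ₑ ^ 2 with hf
  have hfc : Continuous f := (ENNReal.continuous_pow 2).comp (π.continuous_coeff η ξ).enorm
  refine ENNReal.le_of_forall_pos_le_add fun ε hε _ => ?_
  have hε2 : (ε : ℝ≥0∞) / 2 ≠ 0 := ENNReal.div_ne_zero.2 ⟨by simpa using hε.ne', by simp⟩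
  -- Uniformity in the translate is essential: `K` has to be fixed before the approximating `x` is
  -- chosen.
  obtain ⟨K, hK, htail⟩ := exists_isCompact_tsum_diff_le hU hU1 hl hΛ hQ hQ1 (hη ξ).2 hε2
  obtain ⟨x, hx⟩ := exists_tsum_inter_le hU hU1 hl hfc (fun t => by simp [hf]) hP hK hε2
  calc ENNReal.ofReal (A * ‖ξ‖ ^ 2) = ENNReal.ofReal (A * ‖(π.toFun x).symm ξ‖ ^ 2) := by
        rw [LinearIsometryEquiv.norm_map]
    _ ≤ ∑' j, ‖inner ℂ (π.system η Λ j) ((π.toFun x).symm ξ)‖ₑ ^ 2 := hA _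
    _ = ∑' s : ↥(x • Λ), f s := by
        refine Eq.trans ?_ (tsum_image f (MulAction.injective x).injOn).symm
        refine tsum_congr fun j => ?_
        have := π.norm_coeff_mul η ξ x j
        show ‖π.coeff η ((π.toFun x).symm ξ) j‖ₑ ^ 2 = ‖π.coeff η ξ (x * j)‖ₑ ^ 2
        rw [← ofReal_norm, ← ofReal_norm, this]
    _ ≤ ∑' s : ↥((x • Λ ∩ K) ∪ (x • Λ \ K)), f s :=
        ENNReal.tsum_mono_subtype f (Set.inter_union_sdiff _ _).symm.subset
    _ ≤ ∑' s : ↥(x • Λ ∩ K), f s + ∑' s : ↥(x • Λ \ K), f s := ENNReal.tsum_union_le _ _ _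
    _ ≤ (l * (∑' p : P.carrier, f p) + ε / 2) + ε / 2 := add_le_add hx (htail x)
    _ = l * (∑' p : P.carrier, f p) + ε := by rw [add_assoc, ENNReal.add_halves]
    _ = _ := rfl

end Frame

/-! ### Regularized frame operators -/

section Operators

open ContinuousLinearMap

variable {H E J : Type*} [NormedAddCommGroup H] [InnerProductSpace ℂ H] [CompleteSpace H]
  [NormedAddCommGroup E] [InnerProductSpace ℂ E] [CompleteSpace E]

theorem isSelfAdjoint_frameOp (e : J → H) : IsSelfAdjoint (frameOp e) :=
  (isPositive_adjoint_comp_self (analysisOp e)).isSelfAdjoint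

theorem isSelfAdjoint_richardson {S : H →L[ℂ] H} (hS : IsSelfAdjoint S) (B : ℝ) (n : ℕ) :
    IsSelfAdjoint (richardson S B n) := by
  have hB : IsSelfAdjoint ((B : ℂ)⁻¹) := by
    simp [isSelfAdjoint_iff, ← Complex.ofReal_inv]
  exact IsSelfAdjoint.smul hB (isSelfAdjoint_sum _ fun k _ =>
    ((IsSelfAdjoint.one _).sub (IsSelfAdjoint.smul hB hS)).pow k)

theorem norm_adjoint_apply_sq_le {C : H →L[ℂ] E} {B : ℝ} (hB : 0 ≤ B)
    (hC : ∀ x, ‖C x‖ ^ 2 ≤ B * ‖x‖ ^ 2) (c : E) : ‖adjoint C c‖ ^ 2 ≤ B * ‖c‖ ^ 2 := by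
  set t := ‖adjoint C c‖ ^ 2 with ht
  have h1 : t ≤ ‖c‖ * ‖C (adjoint C c)‖ := by
    have h2 : (inner ℂ (adjoint C c) (adjoint C c) : ℂ) = inner ℂ c (C (adjoint C c)) :=
      adjoint_inner_left _ _ _
    have h3 := norm_inner_le_norm (𝕜 := ℂ) c (C (adjoint C c))
    rw [← h2, inner_self_eq_norm_sq_to_K] at h3
    simpa [ht] using h3
  have h2 : t ^ 2 ≤ ‖c‖ ^ 2 * (B * t) := by
    calc t ^ 2 ≤ (‖c‖ * ‖C (adjoint C c)‖) ^ 2 := by gcongr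
      _ ≤ _ := by rw [mul_pow]; gcongr; exact hC _
  rcases (show 0 ≤ t by positivity).eq_or_lt with h0 | h0
  · rw [← h0]
    positivity
  · have : t * t ≤ B * ‖c‖ ^ 2 * t := by nlinarith
    exact le_of_mul_le_mul_right this h0

theorem norm_pow_le_pow_of_le {M : H →L[ℂ] H} {r : ℝ} (h : ‖M‖ ≤ r) (k : ℕ) : ‖M ^ k‖ ≤ r ^ k := by
  rcases Nat.eq_zero_or_pos k with rfl | hk
  · rw [pow_zero, pow_zero]; exact norm_id_le
  · exact (norm_pow_le' _ hk).trans (pow_le_pow_left₀ (norm_nonneg _) h k)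

/-- The growth in `n` is harmless: the bound only provides integrability for fixed `n`. -/
theorem norm_richardson_le {C : H →L[ℂ] E} {B : ℝ} (hB : 0 < B)
    (hC : ∀ x, ‖C x‖ ^ 2 ≤ B * ‖x‖ ^ 2) (n : ℕ) :
    ‖richardson (adjoint C ∘L C) B n‖ ≤ B⁻¹ * n := by
  have h1 : ‖1 - (B : ℂ)⁻¹ • (adjoint C ∘L C)‖ ≤ 1 := by
    simpa using norm_one_sub_smul_adjoint_comp_le (A := 0) hB hB.le (by simp) hC
  rw [richardson, norm_smul, norm_inv, Complex.norm_real, Real.norm_of_nonneg hB.le]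
  gcongr
  refine (norm_sum_le _ _).trans ?_
  refine (Finset.sum_le_card_nsmul _ _ 1 fun k _ => ?_).trans (by simp)
  simpa using norm_pow_le_pow_of_le h1 k

variable {e : J → H} {A B : ℝ}

theorem IsBessel.re_inner_frameOp_le (ξ : H) (B : ℝ) (k : ℕ) :
    (inner ℂ ξ (frameOp e (richardson (frameOp e) B (2 * k) ξ)) : ℂ).re ≤ ‖ξ‖ ^ 2 := by
  have h := inner_adjoint_comp_richardson (analysisOp e) B k ξ
  rw [frameOp, h, Complex.ofReal_re, sub_le_self_iff]
  positivity

/-- The lower frame bound says that the analysis operator is bounded below, so `1 - B⁻¹ C*C` has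
norm at most `1 - A / B`. -/
theorem IsBessel.le_re_inner_frameOp (h : IsBessel e B) (hB : 0 < B) (hAB : A ≤ B)
    (hA : ∀ ξ, ENNReal.ofReal (A * ‖ξ‖ ^ 2) ≤ ∑' j, ‖inner ℂ (e j) ξ‖ₑ ^ 2) (ξ : H) (k : ℕ) :
    (1 - ((1 - A / B) ^ k) ^ 2) * ‖ξ‖ ^ 2 ≤
      (inner ℂ ξ (frameOp e (richardson (frameOp e) B (2 * k) ξ)) : ℂ).re := by
  have h1 := inner_adjoint_comp_richardson (analysisOp e) B k ξ
  have h2 := norm_one_sub_smul_adjoint_comp_le (C := analysisOp e) hB hAB (fun x => by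
    rw [← ENNReal.ofReal_le_ofReal_iff (by positivity), h.norm_analysisOp_sq]
    exact hA x) (h.norm_analysisOp_sq_le hB.le)
  have h3 := ((1 - (B : ℂ)⁻¹ • (adjoint (analysisOp e) ∘L analysisOp e)) ^ k).le_opNorm ξ
  have h4 := norm_pow_le_pow_of_le h2 k
  rw [frameOp, h1, Complex.ofReal_re, one_sub_mul, ← mul_pow]
  gcongr
  exact h3.trans (by gcongr)

/-- Here `e j = C* δ_j`, so the value is `1 - ‖(1 - B⁻¹ CC*)ᵏ δ_j‖²`. -/
theorem IsBessel.re_inner_richardson_le (h : IsBessel e B) (j : J) (k : ℕ) :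
    (inner ℂ (e j) (richardson (frameOp e) B (2 * k) (e j)) : ℂ).re ≤ 1 := by
  classical
  have h1 := inner_adjoint_richardson_adjoint (analysisOp e) B k (lp.single 2 j 1)
  rw [h.adjoint_analysisOp_single, one_smul, lp.norm_single (by norm_num), norm_one, one_pow] at h1
  rw [frameOp, h1, Complex.ofReal_re, sub_le_self_iff]
  positivity

/-- The lower Riesz bound says that `C*` is bounded below, so now `1 - B⁻¹ CC*` has norm at most `1
- A / B`. -/
theorem IsBessel.le_re_inner_richardson (h : IsBessel e B) (hB : 0 < B) (hAB : A ≤ B)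
    (hA : ∀ (F : Finset J) (c : J → ℂ), A * ∑ j ∈ F, ‖c j‖ ^ 2 ≤ ‖∑ j ∈ F, c j • e j‖ ^ 2)
    (j : J) (k : ℕ) :
    1 - ((1 - A / B) ^ k) ^ 2 ≤ (inner ℂ (e j) (richardson (frameOp e) B (2 * k) (e j)) : ℂ).re := by
  classical
  have h1 := inner_adjoint_richardson_adjoint (analysisOp e) B k (lp.single 2 j 1)
  rw [h.adjoint_analysisOp_single, one_smul, lp.norm_single (by norm_num), norm_one, one_pow] at h1
  have h2 := norm_one_sub_smul_adjoint_comp_le (C := adjoint (analysisOp e)) hB hAB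
    (h.le_norm_adjoint_analysisOp_sq hA)
    (norm_adjoint_apply_sq_le hB.le (h.norm_analysisOp_sq_le hB.le))
  rw [adjoint_adjoint] at h2
  have h3 := ((1 - (B : ℂ)⁻¹ • (analysisOp e ∘L adjoint (analysisOp e))) ^ k).le_opNorm
    (lp.single 2 j 1)
  rw [lp.norm_single (by norm_num), norm_one, mul_one] at h3
  have h4 := norm_pow_le_pow_of_le h2 k
  rw [frameOp, h1, Complex.ofReal_re]
  gcongr
  exact h3.trans h4

end Operators

/-! ### Equivariance of frame operators under translation -/

section Equivariance

variable {G : Type*} [Group G] [TopologicalSpace G] {σ : Cocycle G}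
  {H : Type*} [NormedAddCommGroup H] [InnerProductSpace ℂ H] [CompleteSpace H]
  (π : ProjRep σ H) {η : H} {B : ℝ}

namespace ProjRep

/-- The rank-one operator of a vector ignores its phase, so the cocycle drops out of frame
operators. -/
theorem inner_toFun_mul_smul (x y : G) (ξ ζ : H) :
    (inner ℂ (π.toFun (x * y) ξ) ζ : ℂ) • π.toFun (x * y) ξ =
      (inner ℂ (π.toFun x (π.toFun y ξ)) ζ : ℂ) • π.toFun x (π.toFun y ξ) := by
  rw [π.map_mul, inner_smul_left, smul_smul, mul_right_comm, conj_mul_self, one_mul]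

theorem frameOp_smul {S : Set G} (hS : IsBessel (π.system η S) B) (x : G)
    (hxS : IsBessel (π.system η (x • S)) B) (v : H) :
    π.toFun x (frameOp (π.system η S) v) = frameOp (π.system η (x • S)) (π.toFun x v) := by
  let φ : S ≃ ↥(x • S) := Equiv.Set.image (x • ·) S (MulAction.injective x)
  have h1 := (hS.hasSum_frameOp v).mapL (π.toFun x).toContinuousLinearEquiv.toContinuousLinearMap
  have h2 := φ.hasSum_iff.2 (hxS.hasSum_frameOp (π.toFun x v))
  refine h1.unique (h2.congr_fun fun q => ?_)
  refine (map_smul (π.toFun x) _ _).trans (Eq.trans ?_ (π.inner_toFun_mul_smul x q η _).symm)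
  rw [LinearIsometryEquiv.inner_map_map]
  rfl

theorem richardson_frameOp_smul {S : Set G} (hS : IsBessel (π.system η S) B) (x : G)
    (hxS : IsBessel (π.system η (x • S)) B) (n : ℕ) (v : H) :
    π.toFun x (richardson (frameOp (π.system η S)) B n v) =
      richardson (frameOp (π.system η (x • S))) B n (π.toFun x v) :=
  comp_richardson_of_comp_eq (S := frameOp (π.system η S)) (S' := frameOp (π.system η (x • S)))
    (C := (π.toFun x).toContinuousLinearEquiv.toContinuousLinearMap)
    (ContinuousLinearMap.ext fun v => π.frameOp_smul hS x hxS v) B n v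

theorem continuous_toFun_apply : Continuous fun p : G × H => π.toFun p.1 p.2 := by
  refine continuous_iff_continuousAt.2 fun p => ?_
  rw [ContinuousAt, tendsto_iff_norm_sub_tendsto_zero]
  have h1 : Filter.Tendsto (fun q : G × H => ‖q.2 - p.2‖ + ‖π.toFun q.1 p.2 - π.toFun p.1 p.2‖)
      (𝓝 p) (𝓝 0) := by
    have hc : Continuous fun q : G × H => ‖q.2 - p.2‖ + ‖π.toFun q.1 p.2 - π.toFun p.1 p.2‖ :=
      (continuous_snd.sub continuous_const).norm.add
        (((π.strongly_continuous p.2).comp continuous_fst).sub continuous_const).norm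
    simpa using hc.tendsto p
  refine squeeze_zero (fun _ => norm_nonneg _) (fun q => ?_) h1
  calc ‖π.toFun q.1 q.2 - π.toFun p.1 p.2‖
      = ‖π.toFun q.1 (q.2 - p.2) + (π.toFun q.1 p.2 - π.toFun p.1 p.2)‖ := by
        rw [map_sub]; congr 1; abel
    _ ≤ _ := (norm_add_le _ _).trans (by rw [LinearIsometryEquiv.norm_map])

end ProjRep

end Equivariance

/-! ### Measurable dependence of frame operators on the point set -/

section Measurability

open ProbabilityTheory

variable {G : Type*} [Group G] [TopologicalSpace G] [IsTopologicalGroup G] [T2Space G]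
  [LocallyCompactSpace G] [SecondCountableTopology G] [MeasurableSpace G] [BorelSpace G]
  {σ : Cocycle G} {H : Type*} [NormedAddCommGroup H] [InnerProductSpace ℂ H] [CompleteSpace H]
  (π : ProjRep σ H) {η : H} {B : ℝ} {X : Type*} [MeasurableSpace X] {c : X → ClosedSubsets G}

/-- The partial sums over points in a compact set are integrals against the counting kernel, hence
measurable, and along the exhaustion they converge to the frame series. The vector `v` may vary with
`x`, so that the operator can be iterated. -/
theorem ProjRep.stronglyMeasurable_frameOp (hc : Measurable c) (hb : IsLocBounded c)
    (hB : ∀ x, IsBessel (π.system η (c x).carrier) B) {v : X → H} (hv : StronglyMeasurable v) :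
    StronglyMeasurable fun x => frameOp (π.system η (c x).carrier) (v x) := by
  set K := CompactExhaustion.choice G with hK
  have hKm : ∀ n, MeasurableSet (K n) := fun n => (K.isCompact n).measurableSet
  let f : X → G → H := fun x p => (inner ℂ (π.toFun p η) (v x) : ℂ) • (π.toFun p η : H)
  have hf : StronglyMeasurable (Function.uncurry f) := by
    have h1 : StronglyMeasurable fun q : X × G => π.toFun q.2 η :=
      (π.strongly_continuous η).stronglyMeasurable.comp_measurable measurable_snd
    exact (h1.inner (hv.comp_measurable measurable_fst)).smul h1
  have hint : ∀ n, StronglyMeasurable fun x =>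
      ∫ p, (Prod.snd ⁻¹' K n).indicator (Function.uncurry f) (x, p) ∂countKernel hc hb x := fun n =>
    (hf.indicator (measurable_snd (hKm n))).integral_kernel_prod_right'
  refine stronglyMeasurable_of_tendsto Filter.atTop hint ?_
  rw [tendsto_pi_nhds]
  intro x
  have hfin : ∀ n, ((c x).carrier ∩ K n).Finite := fun n => by
    obtain ⟨k, hk⟩ := hb _ (K.isCompact n)
    exact Set.finite_of_encard_le_coe (hk x)
  let F : ℕ → Finset (c x).carrier := fun n =>
    ((hfin n).preimage Subtype.val_injective.injOn).toFinset
  have hFmem : ∀ n (p : (c x).carrier), p ∈ F n ↔ (p : G) ∈ K n := fun n p => by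
    simp [F]
  have hF : Filter.Tendsto F Filter.atTop Filter.atTop := by
    refine Filter.tendsto_atTop_finset_of_monotone (fun i j hij p hp => ?_) fun p => ?_
    · exact (hFmem j p).2 (K.subset hij ((hFmem i p).1 hp))
    · exact (K.exists_mem p).imp fun n hn => (hFmem n p).2 hn
  have hsum : ∀ n, ∫ p, (Prod.snd ⁻¹' K n).indicator (Function.uncurry f) (x, p) ∂countKernel hc hb x =
      ∑ p ∈ F n, f x p := by
    intro n
    have h1 : ∀ p, (Prod.snd ⁻¹' K n).indicator (Function.uncurry f) (x, p) =
        (K n).indicator (f x) p := fun p => rfl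
    simp_rw [h1]
    rw [integral_indicator (hKm n), countKernel_apply, Measure.restrict_restrict (hKm n),
      Set.inter_comm, ← (hfin n).coe_toFinset, setIntegral_finset]
    · simp only [measureReal_def, Measure.count_singleton, ENNReal.toReal_one, one_smul]
      symm
      refine Finset.sum_bij (fun (p : (c x).carrier) _ => (p : G)) ?_ ?_ ?_ ?_
      · intro p hp; simpa using (hFmem n p).1 hp
      · intro p _ q _ hpq; exact Subtype.ext hpq
      · intro p hp
        have hp' := (hfin n).mem_toFinset.1 hp
        exact ⟨⟨p, hp'.1⟩, (hFmem n _).2 hp'.2, rfl⟩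
      · intro p _; rfl
    · rw [← ((hfin n).toFinset : Set G).biUnion_of_singleton]
      exact integrableOn_finset_iUnion.2 fun p _ =>
        integrableOn_singleton (hx := by rw [Measure.count_singleton]; exact ENNReal.one_lt_top)
  simp_rw [hsum]
  exact ((hB x).hasSum_frameOp (v x)).comp hF

theorem ProjRep.stronglyMeasurable_richardson (hc : Measurable c) (hb : IsLocBounded c)
    (hB : ∀ x, IsBessel (π.system η (c x).carrier) B) (n : ℕ) {v : X → H}
    (hv : StronglyMeasurable v) :
    StronglyMeasurable fun x => richardson (frameOp (π.system η (c x).carrier)) B n (v x) := by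
  have hk : ∀ k : ℕ, StronglyMeasurable fun x =>
      ((1 - (B : ℂ)⁻¹ • frameOp (π.system η (c x).carrier)) ^ k) (v x) := by
    intro k
    induction k with
    | zero => simpa using hv
    | succ k ih =>
      have : (fun x => ((1 - (B : ℂ)⁻¹ • frameOp (π.system η (c x).carrier)) ^ (k + 1)) (v x)) =
          fun x => ((1 - (B : ℂ)⁻¹ • frameOp (π.system η (c x).carrier)) ^ k) (v x) -
            (B : ℂ)⁻¹ • frameOp (π.system η (c x).carrier)
              (((1 - (B : ℂ)⁻¹ • frameOp (π.system η (c x).carrier)) ^ k) (v x)) := by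
        ext1 x
        rw [pow_succ', mul_apply_eq_comp]
        rfl
      rw [this]
      exact ih.sub ((π.stronglyMeasurable_frameOp hc hb hB ih).const_smul _)
  have : (fun x => richardson (frameOp (π.system η (c x).carrier)) B n (v x)) = fun x =>
      (B : ℂ)⁻¹ • ∑ k ∈ Finset.range n,
        ((1 - (B : ℂ)⁻¹ • frameOp (π.system η (c x).carrier)) ^ k) (v x) := by
    ext1 x
    rw [richardson, smul_apply, sum_apply]
  rw [this]
  exact (Finset.stronglyMeasurable_fun_sum _ fun k _ => hk k).const_smul _

end Measurability

/-! ### Covolume and formal dimension -/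

section Density

variable {G : Type*} [Group G] [TopologicalSpace G] [IsTopologicalGroup G] [T2Space G]
  [LocallyCompactSpace G] [SecondCountableTopology G] [MeasurableSpace G] [BorelSpace G]
  {σ : Cocycle G} {H : Type*} [NormedAddCommGroup H] [InnerProductSpace ℂ H] [CompleteSpace H]
  {π : ProjRep σ H} {η : H} {B d : ℝ} {m : Measure G} {Λ : Set G}

namespace ProjRep

/-- By equivariance `π(x)` carries the regularized inverse for `x⁻¹P` at `η` to that for `P` at
`π(x)η`. Moving this self-adjoint operator onto `ξ` leaves the frame expansion over `P`. -/
theorem tsum_coeff_toTransversal (hB : ∀ P ∈ hull Λ, IsBessel (π.system η P.carrier) B) (n : ℕ)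
    (ξ : H) (P : PuncturedHull Λ) :
    ∑' x : P.1.carrier, π.coeff (richardson (frameOp (π.system η (P.toTransversal x).1.carrier)) B n
      η) ξ x * conj (π.coeff η ξ x) =
    inner ℂ ξ (frameOp (π.system η P.1.carrier)
      (richardson (frameOp (π.system η P.1.carrier)) B n ξ)) := by
  rw [← ((hB P.1 P.2.1).hasSum_inner_frameOp ξ _).tsum_eq]
  refine tsum_congr fun x => ?_
  have h1 : (x : G) • (P.toTransversal x).1.carrier = P.1.carrier := smul_inv_smul (x : G) P.1.carrier
  have h2 : π.toFun x (richardson (frameOp (π.system η (P.toTransversal x).1.carrier)) B n η) =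
      richardson (frameOp (π.system η P.1.carrier)) B n (π.toFun x η) := by
    have h3 := π.richardson_frameOp_smul (hB _ (P.toTransversal x).2.1) (x : G)
      (by rw [h1]; exact hB P.1 P.2.1) n η
    rwa [h1] at h3
  have h4 := (isSelfAdjoint_richardson (isSelfAdjoint_frameOp (π.system η P.1.carrier)) B n)
  rw [mul_comm, coeff, coeff, inner_conj_symm, h2, ← ContinuousLinearMap.adjoint_inner_right,
    h4.adjoint_eq]
  rfl

theorem IsFormalDimension.integral_norm_coeff_sq (hd : π.IsFormalDimension m d) (η ξ : H) :
    ∫ x, ‖π.coeff η ξ x‖ ^ 2 ∂m = d⁻¹ * ‖ξ‖ ^ 2 * ‖η‖ ^ 2 := by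
  have h := hd.2.2 ξ ξ η η
  have h1 : ∀ x, π.coeff η ξ x * conj (π.coeff η ξ x) = ((‖π.coeff η ξ x‖ ^ 2 : ℝ) : ℂ) := fun x => by
    rw [Complex.mul_conj, Complex.normSq_eq_norm_sq]
  simp_rw [h1] at h
  rw [integral_complex_ofReal, inner_conj_symm, inner_self_eq_norm_sq_to_K,
    inner_self_eq_norm_sq_to_K] at h
  refine Complex.ofReal_injective (h.trans ?_)
  push_cast
  rfl

theorem IsFormalDimension.integrable_prod (hd : π.IsFormalDimension m d) [SFinite m]
    {Z : Type*} [TopologicalSpace Z] [MeasurableSpace Z] {μ₀ : Measure Z} [IsFiniteMeasure μ₀]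
    {h : Z → H} (hm : StronglyMeasurable h) {C : ℝ} (hC : ∀ z, ‖h z‖ ≤ C) (η ξ : H) :
    Integrable (fun p : G × Z => π.coeff (h p.2) ξ p.1 * conj (π.coeff η ξ p.1)) (m.prod μ₀) := by
  have hmeas : StronglyMeasurable
      (fun p : G × Z => π.coeff (h p.2) ξ p.1 * conj (π.coeff η ξ p.1)) := by
    have h1 : StronglyMeasurable fun p : G × Z => π.toFun p.1 (h p.2) :=
      π.continuous_toFun_apply.comp_stronglyMeasurable
        (measurable_fst.stronglyMeasurable.prodMk (hm.comp_measurable measurable_snd))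
    have h2 : StronglyMeasurable fun p : G × Z => conj (π.coeff η ξ p.1) :=
      (Complex.continuous_conj.comp (π.continuous_coeff η ξ)).stronglyMeasurable.comp_measurable
        measurable_fst
    exact (h1.inner stronglyMeasurable_const).mul h2
  rw [integrable_prod_iff' hmeas.aestronglyMeasurable]
  have hint : ∀ z, Integrable (fun x => π.coeff (h z) ξ x * conj (π.coeff η ξ x)) m := fun z =>
    (hd.2.1 ξ (h z)).integrable_mul (hd.2.1 ξ η).star
  refine ⟨Filter.Eventually.of_forall hint, ?_⟩
  refine Integrable.of_bound
    (hmeas.norm.integral_prod_left).aestronglyMeasurable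
    (d⁻¹ * ‖ξ‖ ^ 2 * C ^ 2 + d⁻¹ * ‖ξ‖ ^ 2 * ‖η‖ ^ 2) (Filter.Eventually.of_forall fun z => ?_)
  have hsq : ∀ ζ, Integrable (fun x => ‖π.coeff ζ ξ x‖ ^ 2) m := fun ζ =>
    (memLp_two_iff_integrable_sq_norm (hd.2.1 ξ ζ).1).1 (hd.2.1 ξ ζ)
  rw [Real.norm_of_nonneg (integral_nonneg fun _ => norm_nonneg _)]
  calc ∫ x, ‖π.coeff (h z) ξ x * conj (π.coeff η ξ x)‖ ∂m
      ≤ ∫ x, ‖π.coeff (h z) ξ x‖ ^ 2 + ‖π.coeff η ξ x‖ ^ 2 ∂m := by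
        refine integral_mono (hint z).norm ((hsq _).add (hsq _)) fun x => ?_
        rw [norm_mul, RCLike.norm_conj]
        nlinarith [sq_nonneg (‖π.coeff (h z) ξ x‖ - ‖π.coeff η ξ x‖), sq_nonneg ‖π.coeff (h z) ξ x‖,
          sq_nonneg ‖π.coeff η ξ x‖]
    _ = d⁻¹ * ‖ξ‖ ^ 2 * ‖h z‖ ^ 2 + d⁻¹ * ‖ξ‖ ^ 2 * ‖η‖ ^ 2 := by
        rw [integral_add (hsq _) (hsq _), hd.integral_norm_coeff_sq, hd.integral_norm_coeff_sq]
    _ ≤ _ := by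
        have := inv_nonneg.2 hd.1.le
        gcongr
        exact hC z

end ProjRep

variable [m.IsHaarMeasure]

/-- The trace formula that relates the regularized frame operators over the hull with the
transverse measure. -/
theorem integral_inner_frameOp_richardson (hd : π.IsFormalDimension m d) (hB0 : 0 < B)
    (hB : ∀ P ∈ hull Λ, IsBessel (π.system η P.carrier) B) (hΛ : HullLocBounded Λ)
    {μ : Measure (PuncturedHull Λ)} [SFinite μ] {Z : Transversal Λ}
    {μ₀ : Measure (Transversal Λ)} [IsFiniteMeasure μ₀] (h : campbellMeasure hΛ μ Z = m.prod μ₀)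
    (n : ℕ) (ξ : H) :
    ∫ P : PuncturedHull Λ, (inner ℂ ξ (frameOp (π.system η P.1.carrier)
      (richardson (frameOp (π.system η P.1.carrier)) B n ξ)) : ℂ) ∂μ =
    (d : ℂ)⁻¹ * inner ℂ ξ ξ * ∫ Q : Transversal Λ, conj (inner ℂ η
      (richardson (frameOp (π.system η Q.1.carrier)) B n η) : ℂ) ∂μ₀ := by
  have hBt : ∀ Q : Transversal Λ, IsBessel (π.system η Q.set.carrier) B := fun Q => hB Q.1 Q.2.1
  have hmeas := π.stronglyMeasurable_richardson Transversal.measurable_set hΛ.transversal hBt n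
    (stronglyMeasurable_const (b := η))
  have hbound : ∀ Q : Transversal Λ,
      ‖richardson (frameOp (π.system η Q.set.carrier)) B n η‖ ≤ B⁻¹ * n * ‖η‖ := fun Q =>
    (ContinuousLinearMap.le_opNorm _ _).trans (by
      gcongr
      exact norm_richardson_le hB0 ((hBt Q).norm_analysisOp_sq_le hB0.le) n)
  have h1 := integral_tsum_toTransversal hΛ μ Z h (hd.integrable_prod hmeas hbound η ξ)
  rw [← integral_const_mul]
  refine Eq.trans ?_ (h1.trans ?_)
  · exact integral_congr_ae (Filter.Eventually.of_forall fun P =>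
      (ProjRep.tsum_coeff_toTransversal hB n ξ P).symm)
  · exact integral_congr_ae (Filter.Eventually.of_forall fun Q =>
      hd.2.2 ξ ξ (richardson (frameOp (π.system η Q.1.carrier)) B n η) η)

theorem re_integral_inner_frameOp_richardson (hd : π.IsFormalDimension m d) (hB0 : 0 < B)
    (hB : ∀ P ∈ hull Λ, IsBessel (π.system η P.carrier) B) (hΛ : HullLocBounded Λ)
    {μ : Measure (PuncturedHull Λ)} [IsFiniteMeasure μ] {Z : Transversal Λ}
    {μ₀ : Measure (Transversal Λ)} [IsFiniteMeasure μ₀] (h : campbellMeasure hΛ μ Z = m.prod μ₀)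
    (n : ℕ) (ξ : H) :
    Integrable (fun P : PuncturedHull Λ => (inner ℂ ξ (frameOp (π.system η P.1.carrier)
      (richardson (frameOp (π.system η P.1.carrier)) B n ξ)) : ℂ).re) μ ∧
    Integrable (fun Q : Transversal Λ => (inner ℂ η
      (richardson (frameOp (π.system η Q.1.carrier)) B n η) : ℂ).re) μ₀ ∧
    ∫ P : PuncturedHull Λ, (inner ℂ ξ (frameOp (π.system η P.1.carrier)
      (richardson (frameOp (π.system η P.1.carrier)) B n ξ)) : ℂ).re ∂μ =
    d⁻¹ * ‖ξ‖ ^ 2 * ∫ Q : Transversal Λ, (inner ℂ η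
      (richardson (frameOp (π.system η Q.1.carrier)) B n η) : ℂ).re ∂μ₀ := by
  have hBp : ∀ P : PuncturedHull Λ, IsBessel (π.system η P.set.carrier) B := fun P => hB P.1 P.2.1
  have hBt : ∀ Q : Transversal Λ, IsBessel (π.system η Q.set.carrier) B := fun Q => hB Q.1 Q.2.1
  have hrb : ∀ (C : ClosedSubsets G), C ∈ hull Λ → ∀ v : H,
      ‖richardson (frameOp (π.system η C.carrier)) B n v‖ ≤ B⁻¹ * n * ‖v‖ := fun C hC v =>
    (ContinuousLinearMap.le_opNorm _ _).trans (by
      gcongr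
      exact norm_richardson_le hB0 ((hB C hC).norm_analysisOp_sq_le hB0.le) n)
  have h1 : Integrable (fun P : PuncturedHull Λ => (inner ℂ ξ (frameOp (π.system η P.1.carrier)
      (richardson (frameOp (π.system η P.1.carrier)) B n ξ)) : ℂ)) μ := by
    -- The factor `1 + 1` bounds `1 - (1 - B⁻¹ S)ⁿ`, as `1 - B⁻¹ S` is a contraction.
    refine Integrable.of_bound ?_ (‖ξ‖ * ((1 + 1) * ‖ξ‖)) (Filter.Eventually.of_forall fun P => ?_)
    · exact (stronglyMeasurable_const.inner (π.stronglyMeasurable_frameOp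
        PuncturedHull.measurable_set hΛ.puncturedHull hBp (π.stronglyMeasurable_richardson
          PuncturedHull.measurable_set hΛ.puncturedHull hBp n
          (stronglyMeasurable_const (b := ξ))))).aestronglyMeasurable
    · refine (norm_inner_le_norm _ _).trans ?_
      gcongr
      have h2 := DFunLike.congr_fun (mul_richardson (frameOp (π.system η P.1.carrier)) B n) ξ
      have h3 : ‖1 - (B : ℂ)⁻¹ • frameOp (π.system η P.1.carrier)‖ ≤ 1 := by
        simpa [frameOp] using norm_one_sub_smul_adjoint_comp_le (A := 0) hB0 hB0.le (by simp)
          ((hB P.1 P.2.1).norm_analysisOp_sq_le hB0.le)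
      refine (congrArg norm h2).trans_le ((ContinuousLinearMap.le_opNorm _ _).trans ?_)
      gcongr
      refine (norm_sub_le _ _).trans (add_le_add ContinuousLinearMap.norm_id_le ?_)
      simpa using norm_pow_le_pow_of_le h3 n
  have h2 : Integrable (fun Q : Transversal Λ => (inner ℂ η
      (richardson (frameOp (π.system η Q.1.carrier)) B n η) : ℂ)) μ₀ := by
    refine Integrable.of_bound ?_ (‖η‖ * (B⁻¹ * n * ‖η‖)) (Filter.Eventually.of_forall fun Q => ?_)
    · exact (stronglyMeasurable_const.inner (π.stronglyMeasurable_richardson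
        Transversal.measurable_set hΛ.transversal hBt n
          (stronglyMeasurable_const (b := η)))).aestronglyMeasurable
    · refine (norm_inner_le_norm _ _).trans ?_
      gcongr
      exact hrb Q.1 Q.2.1 η
  refine ⟨h1.re, h2.re, ?_⟩
  have h3 := integral_inner_frameOp_richardson hd hB0 hB hΛ h n ξ
  rw [integral_conj, inner_self_eq_norm_sq_to_K] at h3
  have h4 := congrArg Complex.re h3
  have h5 : (∫ P : PuncturedHull Λ, (inner ℂ ξ (frameOp (π.system η P.1.carrier)
      (richardson (frameOp (π.system η P.1.carrier)) B n ξ)) : ℂ) ∂μ).re = _ :=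
    (integral_re h1).symm
  have h6 : (∫ Q : Transversal Λ, (inner ℂ η
      (richardson (frameOp (π.system η Q.1.carrier)) B n η) : ℂ) ∂μ₀).re = _ :=
    (integral_re h2).symm
  rw [h5] at h4
  refine h4.trans ?_
  have h7 : ((d : ℂ)⁻¹ * ((‖ξ‖ : ℝ) : ℂ) ^ 2) = ((d⁻¹ * ‖ξ‖ ^ 2 : ℝ) : ℂ) := by push_cast; rfl
  refine (congrArg (fun z : ℂ => (z * conj (∫ Q : Transversal Λ, (inner ℂ η
      (richardson (frameOp (π.system η Q.1.carrier)) B n η) : ℂ) ∂μ₀)).re) h7).trans ?_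
  rw [Complex.re_ofReal_mul, Complex.conj_re, h6]
  rfl

/-- The covolume is the inverse of the mass of any product decomposition of the Campbell measure. -/
theorem covol_eq (hΛ : HullLocBounded Λ) {μ : Measure (PuncturedHull Λ)} [IsProbabilityMeasure μ]
    {Z : Transversal Λ} {μ₀ : Measure (Transversal Λ)} [IsFiniteMeasure μ₀]
    (h : campbellMeasure hΛ μ Z = m.prod μ₀) : covol m μ = (ENNReal.ofReal (μ₀.real univ))⁻¹ := by
  have h1 := isTransverseMeasure_of_campbellMeasure_eq hΛ μ Z h
  rw [covol, (isTransverseMeasure_transverseMeasure ⟨μ₀, h1⟩).measure_univ_eq h1, measure_univ,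
    one_div, ofReal_measureReal]

theorem PuncturedHull.nonempty_transversal (P : PuncturedHull Λ) : Nonempty (Transversal Λ) :=
  ⟨P.toTransversal ⟨P.2.2.some, P.2.2.some_mem⟩⟩

theorem tendsto_one_sub_pow_sq {r : ℝ} (h0 : 0 ≤ r) (h1 : r < 1) :
    Filter.Tendsto (fun k : ℕ => 1 - (r ^ k) ^ 2) Filter.atTop (𝓝 1) := by
  simpa using ((tendsto_pow_atTop_nhds_zero_of_lt_one h0 h1).pow 2).const_sub 1

/-- The lower bound on the density of frames. -/
theorem ofReal_mul_covol_le_one [Nontrivial H] (hd : π.IsFormalDimension m d) {A : ℝ} (hA0 : 0 < A)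
    (hAB : A ≤ B) (hB : ∀ P ∈ hull Λ, IsBessel (π.system η P.carrier) B)
    (hA : ∀ P ∈ hull Λ, ∀ ξ, ENNReal.ofReal (A * ‖ξ‖ ^ 2) ≤
      ∑' p, ‖inner ℂ (π.system η P.carrier p) ξ‖ₑ ^ 2) (hΛ : HullLocBounded Λ)
    {μ : Measure (PuncturedHull Λ)} [IsProbabilityMeasure μ]
    [SMulInvariantMeasure G (PuncturedHull Λ) μ] :
    ENNReal.ofReal d * covol m μ ≤ 1 := by
  have hB0 : 0 < B := hA0.trans_le hAB
  obtain ⟨P₀⟩ : Nonempty (PuncturedHull Λ) := nonempty_of_isProbabilityMeasure μ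
  obtain ⟨Z⟩ := P₀.nonempty_transversal
  obtain ⟨μ₀, hfin, h⟩ := exists_campbellMeasure_eq_prod hΛ μ Z m
  obtain ⟨ξ, hξ⟩ := exists_ne (0 : H)
  have hξ' : 0 < ‖ξ‖ ^ 2 := by positivity
  -- In the trace formula of order `2k`, the frame bound controls the left side from below, and the
  -- integrand over the transversal is at most `1`.
  have key : ∀ k : ℕ, (1 - ((1 - A / B) ^ k) ^ 2) * ‖ξ‖ ^ 2 ≤ d⁻¹ * ‖ξ‖ ^ 2 * μ₀.real univ := by
    intro k
    obtain ⟨h1, h2, h3⟩ := re_integral_inner_frameOp_richardson hd hB0 hB hΛ h (2 * k) ξ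
    have h4 := integral_mono (integrable_const _) h1 fun P =>
      (hB P.1 P.2.1).le_re_inner_frameOp hB0 hAB (hA P.1 P.2.1) ξ k
    have h5 := integral_mono h2 (integrable_const (1 : ℝ)) fun Q => by
      have h6 := (hB Q.1 Q.2.1).re_inner_richardson_le ⟨1, Q.2.2⟩ k
      rw [ProjRep.system, π.toFun_one] at h6
      exact h6
    rw [h3, integral_const, probReal_univ, one_smul] at h4
    rw [integral_const, smul_eq_mul, mul_one] at h5
    refine h4.trans ?_
    have := inv_nonneg.2 hd.1.le
    gcongr
  have hlim := le_of_tendsto ((tendsto_one_sub_pow_sq (r := 1 - A / B)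
    (sub_nonneg.2 ((div_le_one hB0).2 hAB)) (by linarith [div_pos hA0 hB0])).mul_const (‖ξ‖ ^ 2))
    (Filter.Eventually.of_forall key)
  have hdi : d ≤ μ₀.real univ := by
    have h1 : ‖ξ‖ ^ 2 * 1 ≤ ‖ξ‖ ^ 2 * (d⁻¹ * μ₀.real univ) := by linarith
    have h2 := le_of_mul_le_mul_left h1 hξ'
    rwa [inv_mul_eq_div, one_le_div hd.1] at h2
  rw [covol_eq hΛ h, ← div_eq_mul_inv]
  exact ENNReal.div_le_of_le_mul (by rw [one_mul]; exact ENNReal.ofReal_le_ofReal hdi)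

/-- The upper bound on the density of Riesz sequences. -/
theorem one_le_ofReal_mul_covol [Nontrivial H] (hd : π.IsFormalDimension m d) {A : ℝ} (hA0 : 0 < A)
    (hAB : A ≤ B) (hB : ∀ P ∈ hull Λ, IsBessel (π.system η P.carrier) B)
    (hA : ∀ P ∈ hull Λ, ∀ (F : Finset P.carrier) (c : P.carrier → ℂ),
      A * ∑ j ∈ F, ‖c j‖ ^ 2 ≤ ‖∑ j ∈ F, c j • π.system η P.carrier j‖ ^ 2)
    (hΛ : HullLocBounded Λ) {μ : Measure (PuncturedHull Λ)} [IsProbabilityMeasure μ]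
    [SMulInvariantMeasure G (PuncturedHull Λ) μ] :
    1 ≤ ENNReal.ofReal d * covol m μ := by
  have hB0 : 0 < B := hA0.trans_le hAB
  obtain ⟨P₀⟩ : Nonempty (PuncturedHull Λ) := nonempty_of_isProbabilityMeasure μ
  obtain ⟨Z⟩ := P₀.nonempty_transversal
  obtain ⟨μ₀, hfin, h⟩ := exists_campbellMeasure_eq_prod hΛ μ Z m
  obtain ⟨ξ, hξ⟩ := exists_ne (0 : H)
  have hξ' : 0 < ‖ξ‖ ^ 2 := by positivity
  -- The roles are reversed: the left integrand is at most `‖ξ‖²`, and the Riesz bound controls the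
  -- integrand over the transversal from below.
  have key : ∀ k : ℕ, d⁻¹ * ‖ξ‖ ^ 2 * (μ₀.real univ * (1 - ((1 - A / B) ^ k) ^ 2)) ≤ ‖ξ‖ ^ 2 := by
    intro k
    obtain ⟨h1, h2, h3⟩ := re_integral_inner_frameOp_richardson hd hB0 hB hΛ h (2 * k) ξ
    have h4 := integral_mono h1 (integrable_const _) fun P =>
      IsBessel.re_inner_frameOp_le (e := π.system η P.1.carrier) ξ B k
    have h5 := integral_mono (integrable_const _) h2 fun Q => by
      have h6 := (hB Q.1 Q.2.1).le_re_inner_richardson hB0 hAB (hA Q.1 Q.2.1) ⟨1, Q.2.2⟩ k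
      rw [ProjRep.system, π.toFun_one] at h6
      exact h6
    rw [h3, integral_const, probReal_univ, one_smul] at h4
    rw [integral_const, smul_eq_mul] at h5
    refine le_trans ?_ h4
    have := inv_nonneg.2 hd.1.le
    gcongr
  have hlim := le_of_tendsto (((tendsto_one_sub_pow_sq (r := 1 - A / B)
    (sub_nonneg.2 ((div_le_one hB0).2 hAB)) (by linarith [div_pos hA0 hB0])).const_mul
      (μ₀.real univ)).const_mul (d⁻¹ * ‖ξ‖ ^ 2))
    (Filter.Eventually.of_forall key)
  have hdi : μ₀.real univ ≤ d := by
    have h1 : ‖ξ‖ ^ 2 * (d⁻¹ * μ₀.real univ) ≤ ‖ξ‖ ^ 2 * 1 := by linarith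
    have h2 := le_of_mul_le_mul_left h1 hξ'
    rwa [inv_mul_eq_div, div_le_one hd.1] at h2
  rw [covol_eq hΛ h, ← ENNReal.mul_inv_cancel (ENNReal.ofReal_pos.2 hd.1).ne' ENNReal.ofReal_ne_top]
  gcongr

theorem countable_of_encard_le {U : Set G} (hU : IsOpen U) (hU1 : 1 ∈ U) {l : ℕ}
    (hl : ∀ x : G, (Λ ∩ x • U).encard ≤ l) : Λ.Countable := by
  obtain ⟨s, hs, hsU⟩ := TopologicalSpace.countable_cover_nhds (f := fun x : G => x • U)
    fun x => (hU.smul x).mem_nhds ⟨1, hU1, by simp⟩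
  have h : Λ = ⋃ x ∈ s, Λ ∩ x • U := by
    rw [← inter_iUnion₂, hsU, inter_univ]
  rw [h]
  exact hs.biUnion fun x _ => (Set.finite_of_encard_le_coe (hl x)).countable

/-- Orbits of admissible vectors that are frames: relative separation and lower density bound. -/
theorem IsFrame.isRelSeparated_and_upperCovol_le [Nontrivial H]
    (hd : π.IsFormalDimension m d) {Q : Set G} (hQ : IsCompact Q) (hQ1 : Q ∈ 𝓝 (1 : G))
    (hη : π.IsAdmissible m Q η) (h : IsFrame (π.system η Λ)) :
    IsRelSeparated Λ ∧ ENNReal.ofReal d * upperCovol m Λ ≤ 1 := by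
  obtain ⟨A, B, hA, hAB, hfr⟩ := h
  have hB0 : 0 ≤ B := hA.le.trans hAB
  have hBes : IsBessel (π.system η Λ) B := fun ξ => (hfr ξ).2
  have hη0 : η ≠ 0 := by
    rintro rfl
    obtain ⟨ξ, hξ⟩ := exists_ne (0 : H)
    have h1 := (hfr ξ).1
    simp only [ProjRep.system, map_zero, inner_zero_left, enorm_zero, ne_eq, OfNat.ofNat_ne_zero,
      not_false_eq_true, zero_pow, tsum_zero, nonpos_iff_eq_zero, ENNReal.ofReal_eq_zero] at h1
    have h2 : 0 < A * ‖ξ‖ ^ 2 := by positivity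
    exact h2.not_ge h1
  obtain ⟨U, hU, hU1, l, hl⟩ := π.exists_encard_le_of_isBessel hη0 hB0 hBes
  have hsep : IsRelSeparated Λ := ⟨U, hU, ⟨1, hU1⟩, l, hl⟩
  refine ⟨hsep, ?_⟩
  have hl' : 1 ≤ (l : ℝ) + 1 := by linarith [(Nat.cast_nonneg l : (0 : ℝ) ≤ l)]
  -- Using `l + 1` instead of the merging factor `l` avoids division by zero and keeps the new bound
  -- below `B`.
  have hlow : ∀ P ∈ hull Λ, ∀ ξ, ENNReal.ofReal (A / (l + 1) * ‖ξ‖ ^ 2) ≤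
      ∑' p, ‖inner ℂ (π.system η P.carrier p) ξ‖ₑ ^ 2 := by
    intro P hP ξ
    have h1 := π.lower_bound_of_mem_hull hU hU1 hl (countable_of_encard_le hU hU1 hl) hQ hQ1 hη
      (fun ξ => (hfr ξ).1) hP ξ
    rw [div_mul_eq_mul_div, ENNReal.ofReal_div_of_pos (by positivity)]
    refine ENNReal.div_le_of_le_mul' (h1.trans ?_)
    gcongr
    rw [← ENNReal.ofReal_natCast]
    exact ENNReal.ofReal_le_ofReal (by linarith)
  rw [upperCovol, ENNReal.mul_iSup]
  refine iSup_le fun μ => ?_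
  rw [ENNReal.mul_iSup]
  refine iSup_le fun hμ => ?_
  have := hμ.1
  have := hμ.2
  exact ofReal_mul_covol_le_one hd (by positivity) ((div_le_self hA.le hl').trans hAB)
    (fun P hP => π.isBessel_of_mem_hull hB0 hBes hP) hlow hsep.hullLocBounded

/-- Orbits that are Riesz sequences: relative separation and upper density bound. -/
theorem IsRieszSequence.isRelSeparated_and_le_lowerCovol [Nontrivial H]
    (hd : π.IsFormalDimension m d) (h : IsRieszSequence (π.system η Λ)) :
    IsRelSeparated Λ ∧ 1 ≤ ENNReal.ofReal d * lowerCovol m Λ := by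
  obtain ⟨A, B, hA, hAB, hBes, hlow⟩ := h.exists_bounds
  have hB0 : 0 ≤ B := hA.le.trans hAB
  have hsep : IsRelSeparated Λ := by
    -- If `η = 0`, the lower Riesz bound on a single index forces `Λ` to be empty.
    rcases eq_or_ne η 0 with rfl | hη0
    · have hΛ : Λ = ∅ := by
        refine eq_empty_of_forall_notMem fun x hx => hA.not_ge ?_
        simpa [ProjRep.system] using hlow {⟨x, hx⟩} 1
      exact ⟨univ, isOpen_univ, univ_nonempty, 0, by simp [hΛ]⟩
    · obtain ⟨U, hU, hU1, l, hl⟩ := π.exists_encard_le_of_isBessel hη0 hB0 hBes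
      exact ⟨U, hU, ⟨1, hU1⟩, l, hl⟩
  refine ⟨hsep, ?_⟩
  have hd0 : ENNReal.ofReal d ≠ 0 := (ENNReal.ofReal_pos.2 hd.1).ne'
  rw [mul_comm, ← ENNReal.div_le_iff_le_mul (Or.inl hd0) (Or.inl ENNReal.ofReal_ne_top)]
  refine le_iInf₂ fun μ hμ => ?_
  have := hμ.1
  have := hμ.2
  rw [ENNReal.div_le_iff_le_mul (Or.inl hd0) (Or.inl ENNReal.ofReal_ne_top), mul_comm]
  exact one_le_ofReal_mul_covol hd hA hAB (fun P hP => π.isBessel_of_mem_hull hB0 hBes hP)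
    (fun P hP => π.le_norm_sum_of_mem_hull hlow hP) hsep.hullLocBounded

end Density

end CoherentSystems

end

/-! ### The density theorem -/

theorem mainTheorem5 {G : Type*} [Group G] [TopologicalSpace G] [IsTopologicalGroup G]
    [T2Space G] [LocallyCompactSpace G] [SecondCountableTopology G]
    [MeasurableSpace G] [BorelSpace G]
    (m : Measure G) [m.IsHaarMeasure] [m.IsMulRightInvariant]
    {H : Type*} [NormedAddCommGroup H] [InnerProductSpace ℂ H] [CompleteSpace H]
    (σ : CoherentSystems.Cocycle G) (π : CoherentSystems.ProjRep σ H)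
    (hπ : π.IsDiscreteSeries m) (Λ : Set G) :
    (∀ Q : Set G, IsCompact Q → Q ∈ 𝓝 (1 : G) → ∀ η : H, π.IsAdmissible m Q η →
      CoherentSystems.IsFrame (fun l : Λ => π.toFun (l : G) η) →
      CoherentSystems.IsRelSeparated Λ ∧
        ENNReal.ofReal (π.formalDimension m) * CoherentSystems.upperCovol m Λ ≤ 1) ∧
    (∀ η : H, CoherentSystems.IsRieszSequence (fun l : Λ => π.toFun (l : G) η) →
      CoherentSystems.IsRelSeparated Λ ∧
        1 ≤ ENNReal.ofReal (π.formalDimension m) * CoherentSystems.lowerCovol m Λ) := by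
  have := CoherentSystems.isInvInvariant_of_isMulRightInvariant m
  have := hπ.1.1
  have hex := hπ.exists_isFormalDimension
  have hd : π.IsFormalDimension m (π.formalDimension m) := by
    rw [CoherentSystems.ProjRep.formalDimension, dif_pos hex]
    exact hex.choose_spec
  exact ⟨fun Q hQ hQ1 η hη h => CoherentSystems.IsFrame.isRelSeparated_and_upperCovol_le hd hQ hQ1
    hη h, fun η h => CoherentSystems.IsRieszSequence.isRelSeparated_and_le_lowerCovol hd h⟩
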